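/- Let $n\ge 1$ and $s\ge 2$, and let $M$ be a smooth manifold of dimension $2n+s$ with a weak metric $f$-structure $(f,Q,\xi_i,\eta^i,g)$, $1\le i\le s$: $f$ is a smooth $(1,1)$-tensor of rank $2n$, $Q$ is a smooth nonsingular $(1,1)$-tensor, $\xi_i$ are smooth vector fields, $\eta^i$ are smooth 1-forms, and $g$ is a Riemannian metric, such that $$f^3+fQ=0,\quad f^2=-Q+\sum_i\eta^i\otimes\xi_i,\quad \eta^i(\xi_j)=\delta^i_j,\quad Q\,\xi_i=\xi_i,$$ the distribution $\bigcap_i\ker\eta^i$ is $f$-invariant, and $g(fX,fY)=g(X,QY)-\sum_i\eta^i(X)\,\eta^i(Y)$ for all vector fields $X,Y$. Let $\nabla$ be the Levi-Civita connection of $g$, and let $\bar\xi=\sum_i\xi_i$, $\bar\eta=\sum_i\eta^i$. Suppose that, for a constant $\beta\ne0$, this is a weak $\beta$-Kenmotsu $f$-manifold, that is, for all vector fields $X,Y$, $$[f,f](X,Y)+2\sum_i d\eta^i(X,Y)\,\xi_i=0,\qquad (\nabla_Xf)Y=\beta\{g(fX,Y)\,\bar\xi-\bar\eta(Y)\,fX\},$$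 where $[f,f](X,Y)=f^2[X,Y]+[fX,fY]-f[fX,Y]-f[X,fY]$ and $2\,d\omega(X,Y)=X(\omega(Y))-Y(\omega(X))-\omega([X,Y])$ for a 1-form $\omega$. Let $R_{X,Y}=[\nabla_X,\nabla_Y]-\nabla_{[X,Y]}$, ${\rm Ric}(X,Y)={\rm trace}(Z\mapsto R_{Z,X}Y)$, $g({\rm Ric}^\sharp X,Y)={\rm Ric}(X,Y)$ and $r={\rm trace}\,{\rm Ric}^\sharp$. If $\nabla_{\xi_i}{\rm Ric}^\sharp=0$ for some index $i$ (in particular, if this holds for all $i$), then $(M,g)$ is $\eta$-Einstein, i.e. there are $a,b\in C^\infty(M)$ with $${\rm Ric}=a\,g+b\sum_i\eta^i\otimes\eta^i+(a+b)\sum_{i\ne j}\eta^i\otimes\eta^j,$$ and its scalar curvature is $r=-2\,s\,n\,(2n+1)\,\beta^2$. -/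

import Mathlib

open scoped Manifold ContDiff
open Bundle

set_option maxSynthPendingDepth 3

noncomputable section

/-! ### Riemannian geometry of a metric given in coordinates

`E` is the coordinate space; `G y` is the matrix of the metric at the coordinate point `y`,
as a bilinear form. All formulas below are the classical coordinate expressions. -/

namespace LocalRiem

variable {E : Type*} [NormedAddCommGroup E] [NormedSpace ℝ E]

/-- Exchange of the last two arguments of a trilinear map. -/
def flipLast {F : Type*} [NormedAddCommGroup F] [NormedSpace ℝ F]
    (T : E →L[ℝ] E →L[ℝ] E →L[ℝ] F) : E →L[ℝ] E →L[ℝ] E →L[ℝ] F :=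
  ((ContinuousLinearMap.flipₗᵢ ℝ E E F).toContinuousLinearEquiv.toContinuousLinearMap) ∘L T

theorem flipLast_apply {F : Type*} [NormedAddCommGroup F] [NormedSpace ℝ F]
    (T : E →L[ℝ] E →L[ℝ] E →L[ℝ] F) (u v w : E) : flipLast T u v w = T u w v := rfl

/-- Christoffel symbols of the first kind:
`(u, v, w) ↦ (1/2) (∂_u G(v, w) + ∂_v G(u, w) - ∂_w G(u, v))`. -/
def christoffelFirst (G : E → E →L[ℝ] E →L[ℝ] ℝ) (y : E) : E →L[ℝ] E →L[ℝ] E →L[ℝ] ℝ :=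
  let D : E →L[ℝ] E →L[ℝ] E →L[ℝ] ℝ := fderiv ℝ G y
  (1 / 2 : ℝ) • (D + D.flip - flipLast D.flip)

theorem christoffelFirst_apply (G : E → E →L[ℝ] E →L[ℝ] ℝ) (y u v w : E) :
    christoffelFirst G y u v w =
      (1 / 2 : ℝ) * (fderiv ℝ G y u v w + fderiv ℝ G y v u w - fderiv ℝ G y w u v) := rfl

/-- Christoffel symbols (of the second kind) of the Levi-Civita connection:
`G (Γ(u, v), w) = christoffelFirst G u v w`. For constant vector fields, `∇_u v = Γ(u, v)`.
(`ContinuousLinearMap.inverse` is the honest inverse where `G y` is nondegenerate and `E` is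
finite-dimensional.) -/
def christoffel (G : E → E →L[ℝ] E →L[ℝ] ℝ) (y : E) : E →L[ℝ] E →L[ℝ] E :=
  (ContinuousLinearMap.compL ℝ E (E →L[ℝ] ℝ) E (G y).inverse) ∘L christoffelFirst G y

theorem christoffel_apply (G : E → E →L[ℝ] E →L[ℝ] ℝ) (y u v : E) :
    christoffel G y u v = (G y).inverse (christoffelFirst G y u v) := rfl

/-- Covariant derivative of a (1,1)-tensor field `A`: `(∇_u A) v = (∂_u A) v + Γ(u, A v) - A Γ(u, v)`,
as the map `u ↦ ∇_u A`. -/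
def covDerivEndo (G : E → E →L[ℝ] E →L[ℝ] ℝ) (A : E → E →L[ℝ] E) (y : E) :
    E →L[ℝ] E →L[ℝ] E :=
  fderiv ℝ A y + (ContinuousLinearMap.compL ℝ E E E).flip (A y) ∘L christoffel G y -
    (ContinuousLinearMap.compL ℝ E E E (A y)) ∘L christoffel G y

theorem covDerivEndo_apply (G : E → E →L[ℝ] E →L[ℝ] ℝ) (A : E → E →L[ℝ] E) (y u v : E) :
    covDerivEndo G A y u v =
      fderiv ℝ A y u v + christoffel G y u (A y v) - A y (christoffel G y u v) := rfl

/-- Curvature tensor `R_{u,v} w` with `R_{X,Y} = [∇_X, ∇_Y] - ∇_{[X,Y]}`. On constant vector fields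
this is `∂_u Γ(v, w) - ∂_v Γ(u, w) + Γ(u, Γ(v, w)) - Γ(v, Γ(u, w))`. -/
def curvature (G : E → E →L[ℝ] E →L[ℝ] ℝ) (y : E) : E →L[ℝ] E →L[ℝ] E →L[ℝ] E :=
  fderiv ℝ (christoffel G) y - (fderiv ℝ (christoffel G) y).flip +
    (ContinuousLinearMap.compL ℝ E E E).bilinearComp (christoffel G y) (christoffel G y) -
    ((ContinuousLinearMap.compL ℝ E E E).bilinearComp (christoffel G y) (christoffel G y)).flip

theorem curvature_apply (G : E → E →L[ℝ] E →L[ℝ] ℝ) (y u v w : E) :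
    curvature G y u v w =
      fderiv ℝ (christoffel G) y u v w - fderiv ℝ (christoffel G) y v u w +
        christoffel G y u (christoffel G y v w) - christoffel G y v (christoffel G y u w) := rfl

variable [FiniteDimensional ℝ E]

/-- The trace of an endomorphism, as a continuous linear form. -/
def traceCLM (E : Type*) [NormedAddCommGroup E] [NormedSpace ℝ E] [FiniteDimensional ℝ E] :
    (E →L[ℝ] E) →L[ℝ] ℝ :=
  LinearMap.toContinuousLinearMap (LinearMap.trace ℝ E ∘ₗ ContinuousLinearMap.coeLM ℝ)

/-- Ricci tensor `Ric(u, v) = trace (w ↦ R_{w,u} v)`. -/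
def ricci (G : E → E →L[ℝ] E →L[ℝ] ℝ) (y : E) : E →L[ℝ] E →L[ℝ] ℝ :=
  (ContinuousLinearMap.compL ℝ E (E →L[ℝ] E) ℝ (traceCLM E)) ∘L flipLast (curvature G y).flip

theorem ricci_apply (G : E → E →L[ℝ] E →L[ℝ] ℝ) (y u v : E) :
    ricci G y u v =
      LinearMap.trace ℝ E (((curvature G y).flip u).flip v : E →L[ℝ] E).toLinearMap := rfl

/-- Ricci operator: `G (Ric♯ u, v) = Ric(u, v)`. -/
def ricciOp (G : E → E →L[ℝ] E →L[ℝ] ℝ) (y : E) : E →L[ℝ] E :=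
  (G y).inverse ∘L ricci G y

/-- Scalar curvature, the metric trace of the Ricci tensor, i.e. the trace of `Ric♯`. -/
def scalarCurvature (G : E → E →L[ℝ] E →L[ℝ] ℝ) (y : E) : ℝ :=
  LinearMap.trace ℝ E (ricciOp G y).toLinearMap

end LocalRiem

/-- The coordinate space of a `(2n+s)`-dimensional manifold. -/
abbrev CoordSpace (n s : ℕ) : Type := EuclideanSpace ℝ (Fin (2 * n + s))

/-! ### Tensor fields on a manifold and their coordinate expressions

`c : M` selects the chart `extChartAt 𝓘(ℝ, E) c` around `c`; a point `y` of its target stands for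
the point `(extChartAt 𝓘(ℝ, E) c).symm y` of the manifold. -/

namespace ChartRep

variable {E : Type*} [NormedAddCommGroup E] [NormedSpace ℝ E]
  {M : Type*} [TopologicalSpace M] [ChartedSpace E M]

/-- The point of `M` with coordinates `y` in the chart at `c`. -/
def pt (c : M) (y : E) : M := (extChartAt 𝓘(ℝ, E) c).symm y

/-- Differential of the inverse chart: coordinate vectors at `y` to tangent vectors. -/
def toTangent (c : M) (y : E) : E →L[ℝ] TangentSpace 𝓘(ℝ, E) (pt c y) :=
  mfderiv 𝓘(ℝ, E) 𝓘(ℝ, E) (extChartAt 𝓘(ℝ, E) c).symm y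

/-- Differential of the chart: tangent vectors to coordinate vectors at `y`. -/
def ofTangent (c : M) (y : E) : TangentSpace 𝓘(ℝ, E) (pt c y) →L[ℝ] E :=
  mfderiv 𝓘(ℝ, E) 𝓘(ℝ, E) (extChartAt 𝓘(ℝ, E) c) (pt c y)

/-- Coordinate expression of a vector field. -/
def vec (ξ : Π p : M, TangentSpace 𝓘(ℝ, E) p) (c : M) (y : E) : E :=
  ofTangent c y (ξ (pt c y))

/-- Coordinate expression of a 1-form. -/
def form (η : Π p : M, TangentSpace 𝓘(ℝ, E) p →L[ℝ] ℝ) (c : M) (y : E) : E →L[ℝ] ℝ :=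
  (η (pt c y)) ∘L toTangent c y

/-- Coordinate expression of a (1,1)-tensor field. -/
def endo (A : Π p : M, TangentSpace 𝓘(ℝ, E) p →L[ℝ] TangentSpace 𝓘(ℝ, E) p) (c : M) (y : E) :
    E →L[ℝ] E :=
  ofTangent c y ∘L A (pt c y) ∘L toTangent c y

/-- Coordinate expression of a (0,2)-tensor field. -/
def bilin (B : Π p : M, TangentSpace 𝓘(ℝ, E) p →L[ℝ] TangentSpace 𝓘(ℝ, E) p →L[ℝ] ℝ)
    (c : M) (y : E) : E →L[ℝ] E →L[ℝ] ℝ :=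
  let b : E →L[ℝ] E →L[ℝ] ℝ := B (pt c y)
  let φ : E →L[ℝ] E := toTangent c y
  b.bilinearComp φ φ

end ChartRep

/-- Nijenhuis torsion `[A,A](X,Y) = A²[X,Y] + [AX,AY] - A[AX,Y] - A[X,AY]` in coordinates. -/
def nijenhuis {E : Type*} [NormedAddCommGroup E] [NormedSpace ℝ E]
    (A : E → E →L[ℝ] E) (X Y : E → E) (y : E) : E :=
  A y (A y (VectorField.lieBracket ℝ X Y y))
    + VectorField.lieBracket ℝ (fun z => A z (X z)) (fun z => A z (Y z)) y
    - A y (VectorField.lieBracket ℝ (fun z => A z (X z)) Y y)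
    - A y (VectorField.lieBracket ℝ X (fun z => A z (Y z)) y)

/-- `dα(X,Y) = (1/2) {X(α(Y)) - Y(α(X)) - α([X,Y])}` in coordinates. -/
def extDerivOneForm {E : Type*} [NormedAddCommGroup E] [NormedSpace ℝ E]
    (α : E → E →L[ℝ] ℝ) (X Y : E → E) (y : E) : ℝ :=
  (1 / 2 : ℝ) * (fderiv ℝ (fun z => α z (Y z)) y (X y) - fderiv ℝ (fun z => α z (X z)) y (Y y)
    - α y (VectorField.lieBracket ℝ X Y y))

/-! ### Weak metric `f`-structures -/

/-- A framed weak `f`-structure `(f, Q, ξ_i, η^i)` on a manifold `M` of dimension `2n+s`, whose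
contact distribution `⋂ ker η^i` is `f`-invariant. -/
structure FramedWeakFStructure (n s : ℕ) (M : Type*) [TopologicalSpace M]
    [ChartedSpace (CoordSpace n s) M] [IsManifold 𝓘(ℝ, CoordSpace n s) ∞ M] where
  f : Π p : M, TangentSpace 𝓘(ℝ, CoordSpace n s) p →L[ℝ] TangentSpace 𝓘(ℝ, CoordSpace n s) p
  Q : Π p : M, TangentSpace 𝓘(ℝ, CoordSpace n s) p →L[ℝ] TangentSpace 𝓘(ℝ, CoordSpace n s) p
  ξ : Fin s → Π p : M, TangentSpace 𝓘(ℝ, CoordSpace n s) p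
  η : Fin s → Π p : M, TangentSpace 𝓘(ℝ, CoordSpace n s) p →L[ℝ] ℝ
  smooth_f : ContMDiff 𝓘(ℝ, CoordSpace n s)
    (𝓘(ℝ, CoordSpace n s).prod 𝓘(ℝ, CoordSpace n s →L[ℝ] CoordSpace n s)) ∞
    (fun p => TotalSpace.mk' (CoordSpace n s →L[ℝ] CoordSpace n s)
      (E := fun p : M => TangentSpace 𝓘(ℝ, CoordSpace n s) p →L[ℝ]
        TangentSpace 𝓘(ℝ, CoordSpace n s) p) p (f p))
  smooth_Q : ContMDiff 𝓘(ℝ, CoordSpace n s)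
    (𝓘(ℝ, CoordSpace n s).prod 𝓘(ℝ, CoordSpace n s →L[ℝ] CoordSpace n s)) ∞
    (fun p => TotalSpace.mk' (CoordSpace n s →L[ℝ] CoordSpace n s)
      (E := fun p : M => TangentSpace 𝓘(ℝ, CoordSpace n s) p →L[ℝ]
        TangentSpace 𝓘(ℝ, CoordSpace n s) p) p (Q p))
  smooth_ξ : ∀ i, ContMDiff 𝓘(ℝ, CoordSpace n s)
    (𝓘(ℝ, CoordSpace n s).prod 𝓘(ℝ, CoordSpace n s)) ∞
    (fun p => TotalSpace.mk' (CoordSpace n s)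
      (E := fun p : M => TangentSpace 𝓘(ℝ, CoordSpace n s) p) p (ξ i p))
  smooth_η : ∀ i, ContMDiff 𝓘(ℝ, CoordSpace n s)
    (𝓘(ℝ, CoordSpace n s).prod 𝓘(ℝ, CoordSpace n s →L[ℝ] ℝ)) ∞
    (fun p => TotalSpace.mk' (CoordSpace n s →L[ℝ] ℝ)
      (E := fun p : M => TangentSpace 𝓘(ℝ, CoordSpace n s) p →L[ℝ] Trivial M ℝ p) p (η i p))
  rank_f : ∀ p, Module.finrank ℝ (LinearMap.range (f p).toLinearMap) = 2 * n
  nonsingular_Q : ∀ p, Function.Bijective (Q p)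
  f_cubed : ∀ p X, f p (f p (f p X)) + f p (Q p X) = 0
  f_squared : ∀ p X, f p (f p X) = -(Q p X) + ∑ i, η i p X • ξ i p
  η_ξ : ∀ p i j, η i p (ξ j p) = if i = j then 1 else 0
  Q_ξ : ∀ p i, Q p (ξ i p) = ξ i p
  f_invariant : ∀ p X, (∀ i, η i p X = 0) → ∀ i, η i p (f p X) = 0

/-- A weak metric `f`-structure: a framed weak `f`-structure with a compatible Riemannian metric. -/
structure WeakMetricFStructure (n s : ℕ) (M : Type*) [TopologicalSpace M]
    [ChartedSpace (CoordSpace n s) M] [IsManifold 𝓘(ℝ, CoordSpace n s) ∞ M]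
    extends FramedWeakFStructure n s M where
  g : ContMDiffRiemannianMetric 𝓘(ℝ, CoordSpace n s) ∞ (CoordSpace n s)
    (fun p : M => TangentSpace 𝓘(ℝ, CoordSpace n s) p)
  compatible : ∀ p X Y, g.inner p (f p X) (f p Y) = g.inner p X (Q p Y) - ∑ i, η i p X * η i p Y

namespace WeakMetricFStructure

variable {n s : ℕ} {M : Type*} [TopologicalSpace M] [ChartedSpace (CoordSpace n s) M]
  [IsManifold 𝓘(ℝ, CoordSpace n s) ∞ M] (S : WeakMetricFStructure n s M)

/-- Coordinate expression of the metric in the chart at `c`. -/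
def localMetric (c : M) : CoordSpace n s → CoordSpace n s →L[ℝ] CoordSpace n s →L[ℝ] ℝ :=
  ChartRep.bilin S.g.inner c

/-- `ξ̄ = ∑ ξ_i`. -/
def xiBar (p : M) : TangentSpace 𝓘(ℝ, CoordSpace n s) p := ∑ i, S.ξ i p

/-- `η̄ = ∑ η^i`. -/
def etaBar (p : M) : TangentSpace 𝓘(ℝ, CoordSpace n s) p →L[ℝ] ℝ := ∑ i, S.η i p

/-- Normality: `[f,f](X,Y) + 2 ∑ dη^i(X,Y) ξ_i = 0` for all smooth vector fields, in every chart. -/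
def IsNormal : Prop :=
  ∀ c : M, ∀ y ∈ (extChartAt 𝓘(ℝ, CoordSpace n s) c).target,
    ∀ X Y : CoordSpace n s → CoordSpace n s, ContDiff ℝ ∞ X → ContDiff ℝ ∞ Y →
      nijenhuis (ChartRep.endo S.f c) X Y y
        + ∑ i, (2 * extDerivOneForm (ChartRep.form (S.η i) c) X Y y) • ChartRep.vec (S.ξ i) c y = 0

/-- Weak `β`-Kenmotsu `f`-manifold: normal, with
`(∇_X f) Y = β {g(f X, Y) ξ̄ - η̄(Y) f X}` (read in every chart). -/
structure IsWeakKenmotsu (β : M → ℝ) : Prop where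
  smooth_β : ContMDiff 𝓘(ℝ, CoordSpace n s) 𝓘(ℝ, ℝ) ∞ β
  β_ne_zero : ∀ p, β p ≠ 0
  normal : S.IsNormal
  nabla_f : ∀ c : M, ∀ y ∈ (extChartAt 𝓘(ℝ, CoordSpace n s) c).target, ∀ X Y : CoordSpace n s,
    LocalRiem.covDerivEndo (S.localMetric c) (ChartRep.endo S.f c) y X Y =
      β (ChartRep.pt c y) •
        (S.localMetric c y (ChartRep.endo S.f c y X) Y • ChartRep.vec S.xiBar c y
          - ChartRep.form S.etaBar c y Y • ChartRep.endo S.f c y X)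

/-- `∇_{ξ_i} Ric♯ = 0` (read in every chart). -/
def NablaXiRicciOpEqZero (i : Fin s) : Prop :=
  ∀ c : M, ∀ y ∈ (extChartAt 𝓘(ℝ, CoordSpace n s) c).target,
    LocalRiem.covDerivEndo (S.localMetric c) (LocalRiem.ricciOp (S.localMetric c)) y
      (ChartRep.vec (S.ξ i) c y) = 0

/-- `Ric = a g + b ∑ η^i ⊗ η^i + (a+b) ∑_{i ≠ j} η^i ⊗ η^j` for some smooth `a, b`
(read in every chart). -/
def IsEtaEinstein : Prop :=
  ∃ a b : M → ℝ, ContMDiff 𝓘(ℝ, CoordSpace n s) 𝓘(ℝ, ℝ) ∞ a ∧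
    ContMDiff 𝓘(ℝ, CoordSpace n s) 𝓘(ℝ, ℝ) ∞ b ∧
    ∀ c : M, ∀ y ∈ (extChartAt 𝓘(ℝ, CoordSpace n s) c).target, ∀ X Y : CoordSpace n s,
      LocalRiem.ricci (S.localMetric c) y X Y =
        a (ChartRep.pt c y) * S.localMetric c y X Y
        + b (ChartRep.pt c y) *
          ∑ i, ChartRep.form (S.η i) c y X * ChartRep.form (S.η i) c y Y
        + (a (ChartRep.pt c y) + b (ChartRep.pt c y)) *
          ∑ i, ∑ j ∈ Finset.univ.filter (fun j => j ≠ i),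
            ChartRep.form (S.η i) c y X * ChartRep.form (S.η j) c y Y

/-- The scalar curvature of `g` is constantly `r` (read in every chart). -/
def HasScalarCurvature (r : ℝ) : Prop :=
  ∀ c : M, ∀ y ∈ (extChartAt 𝓘(ℝ, CoordSpace n s) c).target,
    LocalRiem.scalarCurvature (S.localMetric c) y = r

end WeakMetricFStructure

end

/-!
Write `P` for the projection onto the common kernel `⋂ ker η^k`. Applying normality and the formula
for `∇f` to a pair of vectors gives `dη^k = 0`, and differentiating `f ξ_j = 0` gives
`f (∇_u ξ_j) = β f u`. Hence `∇_u ξ_j - β P u` lies in the span of the `ξ_k`, and it vanishes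
because `g(∇_u ξ_j, ξ_k)` is skew in `j, k` (orthonormality) while `g(∇_u ξ_j, v)` is symmetric in
`u, v` (`dη^j = 0`).

The equation `∇_u ξ_j = β P u` determines `∇P`, hence `R(·, ·) ξ_j` and `R(·, ξ_j)`, and in
particular `Ric(ξ_j, ·) = -2nβ² η̄`. Differentiating `R(·, ξ_j)` once more and tracing the second
Bianchi identity gives, on vectors `v, z` in the image of `P`,
`(∇_{ξ_j} Ric)(v, z) = -2β (Ric(v, z) + 2snβ² g(v, z))`. Since `β ≠ 0`, the vanishing of
`∇_{ξ_j} Ric♯` for a single `j` already forces `Ric = -2snβ² g` on the image of `P`.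
-/

namespace LocalRiem

section Calculus

variable {E F F' : Type*} [NormedAddCommGroup E] [NormedSpace ℝ E] [NormedAddCommGroup F]
  [NormedSpace ℝ F] [NormedAddCommGroup F'] [NormedSpace ℝ F'] {U : Set E} {y : E}

theorem fderiv_clm_apply_apply {A : E → F →L[ℝ] F'} {X : E → F} (hA : DifferentiableAt ℝ A y)
    (hX : DifferentiableAt ℝ X y) (u : E) :
    fderiv ℝ (fun z => A z (X z)) y u = fderiv ℝ A y u (X y) + A y (fderiv ℝ X y u) := by
  rw [fderiv_clm_apply hA hX]
  simp [add_comm]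

theorem fderiv_clm_apply_const {A : E → F →L[ℝ] F'} (hA : DifferentiableAt ℝ A y) (x : F)
    (u : E) : fderiv ℝ (fun z => A z x) y u = fderiv ℝ A y u x := by
  simp [fderiv_clm_apply_apply hA (differentiableAt_const x)]

theorem fderiv_eq_of_eqOn {A B : E → F} (hU : IsOpen U) (hAB : Set.EqOn A B U) (hy : y ∈ U) :
    fderiv ℝ A y = fderiv ℝ B y :=
  (hAB.eventuallyEq_of_mem (hU.mem_nhds hy)).fderiv_eq

theorem differentiableAt_of_contDiffOn {A : E → F} (hU : IsOpen U) (hA : ContDiffOn ℝ ∞ A U)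
    (hy : y ∈ U) : DifferentiableAt ℝ A y :=
  (hA.contDiffAt (hU.mem_nhds hy)).differentiableAt (by simp)

theorem contDiffOn_fderiv {A : E → F} (hU : IsOpen U) (hA : ContDiffOn ℝ ∞ A U) :
    ContDiffOn ℝ ∞ (fderiv ℝ A) U :=
  hA.fderiv_of_isOpen hU (by simp)

theorem fderiv_fderiv_apply_comm {A : E → F} (hU : IsOpen U) (hA : ContDiffOn ℝ ∞ A U)
    (hy : y ∈ U) (u v : E) :
    fderiv ℝ (fun z => fderiv ℝ A z v) y u = fderiv ℝ (fun z => fderiv ℝ A z u) y v := by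
  have hA' := differentiableAt_of_contDiffOn hU (contDiffOn_fderiv hU hA) hy
  rw [fderiv_clm_apply_const hA', fderiv_clm_apply_const hA']
  exact ((hA.contDiffAt (hU.mem_nhds hy)).isSymmSndFDerivAt
    (by simpa using WithTop.coe_le_coe.2 (le_top : (2 : ℕ∞) ≤ ⊤))).eq u v

end Calculus

section Connection

variable {E : Type*} [NormedAddCommGroup E] [NormedSpace ℝ E]
  {G : E → E →L[ℝ] E →L[ℝ] ℝ} {U : Set E} {y : E}

/-- Covariant derivative `∇_u X` of a vector field `X` in the direction of the constant field
`u`. -/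
noncomputable def covDeriv (G : E → E →L[ℝ] E →L[ℝ] ℝ) (u : E) (X : E → E) (y : E) : E :=
  fderiv ℝ X y u + christoffel G y u (X y)

/-- Covariant derivative `(∇_u B)(v, w)` of a `(0,2)`-tensor field `B`. -/
noncomputable def covDerivBilin (G B : E → E →L[ℝ] E →L[ℝ] ℝ) (y u v w : E) : ℝ :=
  fderiv ℝ B y u v w - B y (christoffel G y u v) w - B y v (christoffel G y u w)

/-- Covariant derivative of the curvature tensor: `covDerivCurvature G y w u v x` is
`(∇_w R)_{u,v} x`. -/
noncomputable def covDerivCurvature (G : E → E →L[ℝ] E →L[ℝ] ℝ) (y w : E) :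
    E →L[ℝ] E →L[ℝ] E →L[ℝ] E :=
  fderiv ℝ (curvature G) y w
    + (ContinuousLinearMap.compL ℝ E (E →L[ℝ] E) (E →L[ℝ] E)
        (ContinuousLinearMap.compL ℝ E E E (christoffel G y w)
          - (ContinuousLinearMap.compL ℝ E E E).flip (christoffel G y w))) ∘L curvature G y
    - curvature G y ∘L christoffel G y w
    - (ContinuousLinearMap.compL ℝ E E (E →L[ℝ] E)).flip (christoffel G y w) ∘L curvature G y

theorem covDerivCurvature_apply (G : E → E →L[ℝ] E →L[ℝ] ℝ) (y w u v x : E) :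
    covDerivCurvature G y w u v x = fderiv ℝ (curvature G) y w u v x
      + (christoffel G y w (curvature G y u v x) - curvature G y u v (christoffel G y w x))
      - curvature G y (christoffel G y w u) v x - curvature G y u (christoffel G y w v) x := rfl

theorem curvature_antisymm (G : E → E →L[ℝ] E →L[ℝ] ℝ) (y u v w : E) :
    curvature G y u v w = - curvature G y v u w := by
  rw [curvature_apply, curvature_apply]
  abel

theorem covDeriv_const (G : E → E →L[ℝ] E →L[ℝ] ℝ) (u x y : E) :
    covDeriv G u (fun _ => x) y = christoffel G y u x := by
  simp [covDeriv]

theorem covDeriv_congr {X Y : E → E} (hU : IsOpen U) (hXY : Set.EqOn X Y U) (hy : y ∈ U) (u : E) :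
    covDeriv G u X y = covDeriv G u Y y := by
  rw [covDeriv, covDeriv, fderiv_eq_of_eqOn hU hXY hy, hXY hy]

theorem covDeriv_fun_sub {X Y : E → E} (hX : DifferentiableAt ℝ X y)
    (hY : DifferentiableAt ℝ Y y) (u : E) :
    covDeriv G u (fun z => X z - Y z) y = covDeriv G u X y - covDeriv G u Y y := by
  simp only [covDeriv, fderiv_fun_sub hX hY, sub_apply, map_sub]
  abel

theorem covDeriv_fun_sum {ι : Type*} [Fintype ι] {X : ι → E → E}
    (hX : ∀ k, DifferentiableAt ℝ (X k) y) (u : E) :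
    covDeriv G u (fun z => ∑ k, X k z) y = ∑ k, covDeriv G u (X k) y := by
  simp only [covDeriv, fderiv_fun_sum fun k _ => hX k, sum_apply, map_sum, Finset.sum_add_distrib]

theorem covDeriv_fun_smul {φ : E → ℝ} {X : E → E} (hφ : DifferentiableAt ℝ φ y)
    (hX : DifferentiableAt ℝ X y) (u : E) :
    covDeriv G u (fun z => φ z • X z) y = fderiv ℝ φ y u • X y + φ y • covDeriv G u X y := by
  simp only [covDeriv, fderiv_fun_smul hφ hX, add_apply, smul_apply,
    ContinuousLinearMap.smulRight_apply, map_smul]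
  module

theorem covDeriv_fun_const_smul {X : E → E} (c : ℝ) (hX : DifferentiableAt ℝ X y) (u : E) :
    covDeriv G u (fun z => c • X z) y = c • covDeriv G u X y := by
  simp [covDeriv_fun_smul (differentiableAt_const c) hX]

theorem covDeriv_clm_apply {A : E → E →L[ℝ] E} {X : E → E} (hA : DifferentiableAt ℝ A y)
    (hX : DifferentiableAt ℝ X y) (u : E) :
    covDeriv G u (fun z => A z (X z)) y =
      covDerivEndo G A y u (X y) + A y (covDeriv G u X y) := by
  simp only [covDeriv, covDerivEndo_apply, fderiv_clm_apply_apply hA hX, map_add]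
  abel

theorem fderiv_bilin_apply {B : E → E →L[ℝ] E →L[ℝ] ℝ} {X Y : E → E}
    (hB : DifferentiableAt ℝ B y) (hX : DifferentiableAt ℝ X y) (hY : DifferentiableAt ℝ Y y)
    (u : E) :
    fderiv ℝ (fun z => B z (X z) (Y z)) y u = covDerivBilin G B y u (X y) (Y y)
      + B y (covDeriv G u X y) (Y y) + B y (X y) (covDeriv G u Y y) := by
  rw [fderiv_clm_apply_apply (hB.clm_apply hX) hY, fderiv_clm_apply_apply hB hX]
  simp only [covDerivBilin, covDeriv, map_add, add_apply]
  ring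

theorem covDeriv_curvature_apply {V W X : E → E} (hR : DifferentiableAt ℝ (curvature G) y)
    (hV : DifferentiableAt ℝ V y) (hW : DifferentiableAt ℝ W y) (hX : DifferentiableAt ℝ X y)
    (u : E) :
    covDeriv G u (fun z => curvature G z (V z) (W z) (X z)) y =
      covDerivCurvature G y u (V y) (W y) (X y) + curvature G y (covDeriv G u V y) (W y) (X y)
        + curvature G y (V y) (covDeriv G u W y) (X y)
        + curvature G y (V y) (W y) (covDeriv G u X y) := by
  simp only [covDeriv, covDerivCurvature_apply,
    fderiv_clm_apply_apply ((hR.clm_apply hV).clm_apply hW) hX,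
    fderiv_clm_apply_apply (hR.clm_apply hV) hW, fderiv_clm_apply_apply hR hV, map_add, add_apply]
  abel

theorem covDerivCurvature_antisymm (hR : DifferentiableAt ℝ (curvature G) y) (w u v x : E) :
    covDerivCurvature G y w u v x = - covDerivCurvature G y w v u x := by
  have hR' : fderiv ℝ (curvature G) y w u v x = - fderiv ℝ (curvature G) y w v u x := by
    have happly (u v : E) :
        fderiv ℝ (fun z => curvature G z u v x) y w = fderiv ℝ (curvature G) y w u v x := by
      rw [fderiv_clm_apply_const (by fun_prop), fderiv_clm_apply_const (by fun_prop),
        fderiv_clm_apply_const hR]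
    rw [← happly, ← happly, ← neg_apply, ← fderiv_fun_neg]
    simp only [← curvature_antisymm]
  rw [covDerivCurvature_apply, covDerivCurvature_apply, hR', curvature_antisymm G y u v,
    curvature_antisymm G y u v, curvature_antisymm G y _ v, curvature_antisymm G y u, map_neg]
  abel

theorem contDiffOn_covDeriv {X : E → E} (hU : IsOpen U) (hΓ : ContDiffOn ℝ ∞ (christoffel G) U)
    (hX : ContDiffOn ℝ ∞ X U) (u : E) : ContDiffOn ℝ ∞ (covDeriv G u X) U :=
  ((contDiffOn_fderiv hU hX).clm_apply contDiffOn_const).add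
    ((hΓ.clm_apply contDiffOn_const).clm_apply hX)

theorem covDeriv_commutator {X : E → E} (hU : IsOpen U) (hΓ : ContDiffOn ℝ ∞ (christoffel G) U)
    (hX : ContDiffOn ℝ ∞ X U) (hy : y ∈ U) (u v : E) :
    covDeriv G u (covDeriv G v X) y - covDeriv G v (covDeriv G u X) y =
      curvature G y u v (X y) := by
  have hΓy := differentiableAt_of_contDiffOn hU hΓ hy
  have hXy := differentiableAt_of_contDiffOn hU hX hy
  have hX' := differentiableAt_of_contDiffOn hU (contDiffOn_fderiv hU hX) hy
  have second (u v : E) : covDeriv G u (covDeriv G v X) y =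
      fderiv ℝ (fun z => fderiv ℝ X z v) y u
        + (fderiv ℝ (christoffel G) y u v (X y) + christoffel G y v (fderiv ℝ X y u))
        + (christoffel G y u (fderiv ℝ X y v) + christoffel G y u (christoffel G y v (X y))) := by
    unfold covDeriv
    rw [fderiv_fun_add (by fun_prop) (by fun_prop), add_apply,
      fderiv_clm_apply_apply (by fun_prop) hXy, fderiv_clm_apply_const hΓy, map_add]
  rw [second, second, fderiv_fderiv_apply_comm hU hX hy u v, curvature_apply]
  abel

end Connection

/-- `G` is a smooth Riemannian metric on the open set `U` of the coordinate space. -/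
structure IsMetricOn {E : Type*} [NormedAddCommGroup E] [NormedSpace ℝ E]
    (G : E → E →L[ℝ] E →L[ℝ] ℝ) (U : Set E) : Prop where
  isOpen : IsOpen U
  smooth : ContDiffOn ℝ ∞ G U
  symm : ∀ y ∈ U, ∀ u v, G y u v = G y v u
  pos : ∀ y ∈ U, ∀ u, u ≠ 0 → 0 < G y u u

namespace IsMetricOn

variable {E : Type*} [NormedAddCommGroup E] [NormedSpace ℝ E]
  {G : E → E →L[ℝ] E →L[ℝ] ℝ} {U : Set E} (h : IsMetricOn G U)
include h

theorem differentiableAt {y : E} (hy : y ∈ U) : DifferentiableAt ℝ G y :=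
  differentiableAt_of_contDiffOn h.isOpen h.smooth hy

theorem eq_of_inner_eq {y : E} (hy : y ∈ U) {a b : E} (hab : ∀ w, G y a w = G y b w) : a = b := by
  by_contra hne
  have hpos := h.pos y hy (a - b) (sub_ne_zero.2 hne)
  simp [hab] at hpos

theorem fderiv_symm {y : E} (hy : y ∈ U) (u v w : E) :
    fderiv ℝ G y u v w = fderiv ℝ G y u w v := by
  have hG := h.differentiableAt hy
  have hsymm := fderiv_eq_of_eqOn h.isOpen (fun z hz => h.symm z hz v w) hy
  simpa only [fderiv_clm_apply_const, hG, DifferentiableAt.clm_apply, differentiableAt_const]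
    using DFunLike.congr_fun hsymm u

variable [FiniteDimensional ℝ E]

theorem isInvertible {y : E} (hy : y ∈ U) : (G y).IsInvertible := by
  have hinj : Function.Injective (G y) := fun a b hab =>
    h.eq_of_inner_eq hy fun w => by rw [hab]
  have hdim : Module.finrank ℝ E = Module.finrank ℝ (E →L[ℝ] ℝ) := by
    rw [← (LinearMap.toContinuousLinearMap : (E →ₗ[ℝ] ℝ) ≃ₗ[ℝ] _).finrank_eq]
    exact (Subspace.dual_finrank_eq (K := ℝ) (V := E)).symm
  exact ⟨(LinearEquiv.ofInjectiveOfFinrankEq (G y).toLinearMap hinj hdim).toContinuousLinearEquiv,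
    by ext; rfl⟩

theorem inner_inverse {y : E} (hy : y ∈ U) (φ : E →L[ℝ] ℝ) (w : E) :
    G y ((G y).inverse φ) w = φ w := by
  rw [(h.isInvertible hy).self_apply_inverse]

section Smoothness

theorem contDiffOn_inverse : ContDiffOn ℝ ∞ (fun z => (G z).inverse) U := fun z hz =>
  (h.isInvertible hz).contDiffAt_map_inverse.comp_contDiffWithinAt z (h.smooth z hz)

theorem contDiffOn_christoffelFirst : ContDiffOn ℝ ∞ (christoffelFirst G) U := by
  have hG' := contDiffOn_fderiv h.isOpen h.smooth
  refine contDiffOn_clm_apply.2 fun u => contDiffOn_clm_apply.2 fun v =>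
    contDiffOn_clm_apply.2 fun w => ?_
  simp only [christoffelFirst_apply]
  fun_prop

theorem contDiffOn_christoffel : ContDiffOn ℝ ∞ (christoffel G) U := by
  have hΓ := h.contDiffOn_christoffelFirst
  have hinv := h.contDiffOn_inverse
  refine contDiffOn_clm_apply.2 fun u => contDiffOn_clm_apply.2 fun v => ?_
  simp only [christoffel_apply]
  fun_prop

theorem contDiffOn_curvature : ContDiffOn ℝ ∞ (curvature G) U := by
  have hΓ := h.contDiffOn_christoffel
  have hΓ' := contDiffOn_fderiv h.isOpen hΓ
  refine contDiffOn_clm_apply.2 fun u => contDiffOn_clm_apply.2 fun v =>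
    contDiffOn_clm_apply.2 fun w => ?_
  simp only [curvature_apply]
  fun_prop

theorem differentiableAt_curvature {y : E} (hy : y ∈ U) : DifferentiableAt ℝ (curvature G) y :=
  differentiableAt_of_contDiffOn h.isOpen h.contDiffOn_curvature hy

end Smoothness

variable {y : E} (hy : y ∈ U)
include hy

theorem inner_christoffel (u v w : E) :
    G y (christoffel G y u v) w = christoffelFirst G y u v w := by
  rw [christoffel_apply, h.inner_inverse hy]

theorem christoffel_symm (u v : E) : christoffel G y u v = christoffel G y v u :=
  h.eq_of_inner_eq hy fun w => by
    rw [h.inner_christoffel hy, h.inner_christoffel hy, christoffelFirst_apply,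
      christoffelFirst_apply, h.fderiv_symm hy w u v]
    ring

theorem covDerivBilin_metric (u v w : E) : covDerivBilin G G y u v w = 0 := by
  rw [covDerivBilin, h.symm y hy v, h.inner_christoffel hy, h.inner_christoffel hy,
    christoffelFirst_apply, christoffelFirst_apply, h.fderiv_symm hy u w v]
  ring

theorem fderiv_inner {X Y : E → E} (hX : DifferentiableAt ℝ X y) (hY : DifferentiableAt ℝ Y y)
    (u : E) : fderiv ℝ (fun z => G z (X z) (Y z)) y u =
      G y (covDeriv G u X y) (Y y) + G y (X y) (covDeriv G u Y y) := by
  rw [fderiv_bilin_apply (G := G) (h.differentiableAt hy) hX hY, h.covDerivBilin_metric hy,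
    zero_add]

theorem bianchi_first (u v w : E) :
    curvature G y u v w + curvature G y v w u + curvature G y w u v = 0 := by
  have hΓ := differentiableAt_of_contDiffOn h.isOpen h.contDiffOn_christoffel hy
  have hsymm (u v w : E) :
      fderiv ℝ (christoffel G) y u v w = fderiv ℝ (christoffel G) y u w v := by
    have hvw := fderiv_eq_of_eqOn h.isOpen (fun z hz => h.christoffel_symm hz v w) hy
    simpa only [fderiv_clm_apply_const, hΓ, DifferentiableAt.clm_apply, differentiableAt_const]
      using DFunLike.congr_fun hvw u
  simp only [curvature_apply]
  rw [hsymm u w v, hsymm v w u, hsymm w v u, h.christoffel_symm hy w v,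
    h.christoffel_symm hy u w, h.christoffel_symm hy v u]
  abel

theorem inner_curvature_skew (u v a b : E) :
    G y (curvature G y u v a) b = - G y (curvature G y u v b) a := by
  have hΓ := h.contDiffOn_christoffel
  have hconst (c : E) : ContDiffOn ℝ ∞ (fun _ : E => c) U := contDiffOn_const
  have smooth_covDeriv (u c : E) := contDiffOn_covDeriv h.isOpen hΓ (hconst c) u
  have hdiff (u c : E) : DifferentiableAt ℝ (covDeriv G u fun _ => c) y :=
    differentiableAt_of_contDiffOn h.isOpen (smooth_covDeriv u c) hy
  have first (z : E) (hz : z ∈ U) (v : E) : fderiv ℝ (fun z => G z a b) z v =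
      G z (covDeriv G v (fun _ => a) z) b + G z a (covDeriv G v (fun _ => b) z) :=
    h.fderiv_inner hz (differentiableAt_const a) (differentiableAt_const b) v
  have second (u v : E) : fderiv ℝ (fun z => fderiv ℝ (fun z => G z a b) z v) y u =
      G y (covDeriv G u (covDeriv G v fun _ => a) y) b
        + G y (covDeriv G v (fun _ => a) y) (covDeriv G u (fun _ => b) y)
        + (G y (covDeriv G u (fun _ => a) y) (covDeriv G v (fun _ => b) y)
          + G y a (covDeriv G u (covDeriv G v fun _ => b) y)) := by
    have hG := h.differentiableAt hy
    rw [fderiv_eq_of_eqOn h.isOpen (fun z hz => first z hz v) hy,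
      fderiv_fun_add (by fun_prop) (by fun_prop), add_apply,
      h.fderiv_inner hy (hdiff v a) (differentiableAt_const b),
      h.fderiv_inner hy (differentiableAt_const a) (hdiff v b)]
  have hG : ContDiffOn ℝ ∞ (fun z => G z a b) U :=
    (h.smooth.clm_apply contDiffOn_const).clm_apply contDiffOn_const
  have hcomm := fderiv_fderiv_apply_comm h.isOpen hG hy u v
  rw [second, second] at hcomm
  rw [← covDeriv_commutator h.isOpen hΓ (hconst a) hy, h.symm y hy _ a,
    ← covDeriv_commutator h.isOpen hΓ (hconst b) hy]
  simp only [map_sub]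
  rw [← h.symm y hy _ a, ← h.symm y hy _ a, sub_apply]
  linarith [h.symm y hy a (covDeriv G u (covDeriv G v fun _ => b) y),
    h.symm y hy a (covDeriv G v (covDeriv G u fun _ => b) y)]

theorem inner_curvature_pair (u v a b : E) :
    G y (curvature G y u v a) b = G y (curvature G y a b u) v := by
  have bianchi (u v a b : E) : G y (curvature G y u v a) b + G y (curvature G y v a u) b
      + G y (curvature G y a u v) b = 0 := by
    simpa using congrArg (fun x => G y x b) (h.bianchi_first hy u v a)
  have skew := h.inner_curvature_skew hy
  have antisymm (u v a b : E) :
      G y (curvature G y u v a) b = - G y (curvature G y v u a) b := by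
    rw [curvature_antisymm, map_neg, neg_apply]
  linarith [bianchi u v a b, bianchi v a b u, bianchi a b u v, bianchi b u v a, skew v a b u,
    skew a b v u, skew a u b v, skew b u a v, skew u v b a, skew v b u a, antisymm b v a u,
    antisymm u a b v]

/-- The Jacobi identity for the operators `∇_u`, `∇_v`, `∇_w`, applied to the constant field `x`. -/
theorem cyclic_sum_covDeriv_curvature (u v w x : E) :
    (covDeriv G u (fun z => curvature G z v w x) y - curvature G y v w (christoffel G y u x))
    + (covDeriv G v (fun z => curvature G z w u x) y - curvature G y w u (christoffel G y v x))
    + (covDeriv G w (fun z => curvature G z u v x) y - curvature G y u v (christoffel G y w x))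
      = 0 := by
  have hΓ := h.contDiffOn_christoffel
  have hx : ContDiffOn ℝ ∞ (fun _ : E => x) U := contDiffOn_const
  have smooth_second (v w : E) : DifferentiableAt ℝ (covDeriv G v (covDeriv G w fun _ => x)) y :=
    differentiableAt_of_contDiffOn h.isOpen
      (contDiffOn_covDeriv h.isOpen hΓ (contDiffOn_covDeriv h.isOpen hΓ hx w) v) hy
  have outer (u v w : E) : covDeriv G u (fun z => curvature G z v w x) y =
      covDeriv G u (covDeriv G v (covDeriv G w fun _ => x)) y
        - covDeriv G u (covDeriv G w (covDeriv G v fun _ => x)) y := by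
    rw [← covDeriv_fun_sub (smooth_second v w) (smooth_second w v)]
    exact covDeriv_congr h.isOpen
      (fun z hz => (covDeriv_commutator h.isOpen hΓ hx hz v w).symm) hy u
  have inner (u v w : E) : curvature G y v w (christoffel G y u x) =
      covDeriv G v (covDeriv G w (covDeriv G u fun _ => x)) y
        - covDeriv G w (covDeriv G v (covDeriv G u fun _ => x)) y := by
    rw [covDeriv_commutator h.isOpen hΓ (contDiffOn_covDeriv h.isOpen hΓ hx u) hy, covDeriv_const]
  rw [outer, outer, outer, inner, inner, inner]
  abel

theorem bianchi_second (u v w x : E) :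
    covDerivCurvature G y u v w x + covDerivCurvature G y v w u x + covDerivCurvature G y w u v x
      = 0 := by
  have hcyclic := h.cyclic_sum_covDeriv_curvature hy u v w x
  have hR := h.differentiableAt_curvature hy
  have leibniz (u v w : E) := covDeriv_curvature_apply hR (differentiableAt_const v)
    (differentiableAt_const w) (differentiableAt_const x) u
  simp only [leibniz, covDeriv_const] at hcyclic
  rw [← hcyclic, curvature_antisymm G y v (christoffel G y u w),
    curvature_antisymm G y w (christoffel G y v u), curvature_antisymm G y u (christoffel G y w v),
    h.christoffel_symm hy v u, h.christoffel_symm hy w v, h.christoffel_symm hy u w]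
  abel

end IsMetricOn

section Ricci

variable {E : Type*} [NormedAddCommGroup E] [NormedSpace ℝ E] [FiniteDimensional ℝ E]

theorem traceCLM_id : traceCLM E (ContinuousLinearMap.id ℝ E) = Module.finrank ℝ E :=
  LinearMap.trace_id ℝ E

theorem traceCLM_smulRight (φ : E →L[ℝ] ℝ) (x : E) : traceCLM E (φ.smulRight x) = φ x :=
  LinearMap.trace_smulRight φ.toLinearMap x

theorem traceCLM_comp_comm (A B : E →L[ℝ] E) : traceCLM E (A ∘L B) = traceCLM E (B ∘L A) :=
  LinearMap.trace_comp_comm' B.toLinearMap A.toLinearMap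

/-- The contraction `R ↦ ((v, z) ↦ trace (u ↦ R(u, v) z))` producing the Ricci tensor from the
curvature tensor. -/
noncomputable def ricciContraction (E : Type*) [NormedAddCommGroup E] [NormedSpace ℝ E]
    [FiniteDimensional ℝ E] : (E →L[ℝ] E →L[ℝ] E →L[ℝ] E) →L[ℝ] (E →L[ℝ] E →L[ℝ] ℝ) :=
  LinearMap.toContinuousLinearMap
    { toFun := fun R => (ContinuousLinearMap.compL ℝ E (E →L[ℝ] E) ℝ (traceCLM E)) ∘L
        flipLast R.flip
      map_add' := fun R R' => by
        ext v z
        exact map_add (traceCLM E) ((R.flip v).flip z) ((R'.flip v).flip z)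
      map_smul' := fun c R => by
        ext v z
        exact map_smul (traceCLM E) c ((R.flip v).flip z) }

theorem ricciContraction_apply (R : E →L[ℝ] E →L[ℝ] E →L[ℝ] E) (v z : E) :
    ricciContraction E R v z = traceCLM E ((R.flip v).flip z) := rfl

theorem ricci_eq_traceCLM (G : E → E →L[ℝ] E →L[ℝ] ℝ) (y u v : E) : ricci G y u v =
    traceCLM E (((curvature G y).flip u).flip v) := rfl

theorem covDerivBilin_ricci {G : E → E →L[ℝ] E →L[ℝ] ℝ} {y : E}
    (hR : DifferentiableAt ℝ (curvature G) y) (w v z : E) :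
    covDerivBilin G (ricci G) y w v z =
      traceCLM E (((covDerivCurvature G y w).flip v).flip z) := by
  have hRic : fderiv ℝ (ricci G) y w v z =
      traceCLM E (((fderiv ℝ (curvature G) y w).flip v).flip z) := by
    have hcomp : HasFDerivAt (ricci G) (ricciContraction E ∘L fderiv ℝ (curvature G) y) y :=
      (ricciContraction E).hasFDerivAt.comp y hR.hasFDerivAt
    rw [hcomp.fderiv, ContinuousLinearMap.comp_apply, ricciContraction_apply]
  have hsplit : ((covDerivCurvature G y w).flip v).flip z =
      ((fderiv ℝ (curvature G) y w).flip v).flip z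
        + christoffel G y w ∘L ((curvature G y).flip v).flip z
        - ((curvature G y).flip v).flip (christoffel G y w z)
        - ((curvature G y).flip v).flip z ∘L christoffel G y w
        - ((curvature G y).flip (christoffel G y w v)).flip z := by
    ext u
    simp only [ContinuousLinearMap.flip_apply, covDerivCurvature_apply, add_apply, sub_apply,
      ContinuousLinearMap.comp_apply]
    abel
  rw [hsplit, covDerivBilin, hRic]
  simp only [map_add, map_sub, traceCLM_comp_comm (christoffel G y w), ricci_eq_traceCLM]
  ring

namespace IsMetricOn

variable {G : E → E →L[ℝ] E →L[ℝ] ℝ} {U : Set E} (h : IsMetricOn G U)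
include h

theorem contDiffOn_ricci : ContDiffOn ℝ ∞ (ricci G) U :=
  (ricciContraction E).contDiff.comp_contDiffOn h.contDiffOn_curvature

theorem contDiffOn_ricciOp : ContDiffOn ℝ ∞ (ricciOp G) U :=
  h.contDiffOn_inverse.clm_comp h.contDiffOn_ricci

variable {y : E} (hy : y ∈ U)
include hy

theorem traceCLM_eq_of_adjoint {A B : E →L[ℝ] E} (hAB : ∀ u v, G y (A u) v = G y u (B v)) :
    traceCLM E A = traceCLM E B := by
  obtain ⟨g, hg⟩ := h.isInvertible hy
  let e : E ≃ₗ[ℝ] Module.Dual ℝ E :=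
    g.toLinearEquiv.trans LinearMap.toContinuousLinearMap.symm
  have he (x v : E) : e x v = G y x v := by rw [← hg]; rfl
  have hconj : e.conj A.toLinearMap = Module.Dual.transpose B.toLinearMap := by
    ext φ v
    obtain ⟨u, rfl⟩ := e.surjective φ
    simpa [LinearEquiv.conj_apply, he, Module.Dual.transpose_apply] using hAB u v
  change LinearMap.trace ℝ E A.toLinearMap = LinearMap.trace ℝ E B.toLinearMap
  rw [← LinearMap.trace_conj' A.toLinearMap e, hconj, LinearMap.trace_transpose']

theorem ricci_symm (u v : E) : ricci G y u v = ricci G y v u := by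
  rw [ricci_eq_traceCLM, ricci_eq_traceCLM]
  refine h.traceCLM_eq_of_adjoint hy fun w x => ?_
  simp only [ContinuousLinearMap.flip_apply]
  rw [h.inner_curvature_pair hy, h.inner_curvature_skew hy, curvature_antisymm, map_neg,
    neg_apply, neg_neg, h.symm y hy w]

theorem inner_ricciOp (u v : E) : G y (ricciOp G y u) v = ricci G y u v :=
  h.inner_inverse hy _ _

theorem covDerivBilin_ricci_eq_inner (w v z : E) :
    covDerivBilin G (ricci G) y w v z = G y (covDerivEndo G (ricciOp G) y w v) z := by
  have hOp := differentiableAt_of_contDiffOn h.isOpen h.contDiffOn_ricciOp hy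
  have hRic := differentiableAt_of_contDiffOn h.isOpen h.contDiffOn_ricci hy
  have hv := differentiableAt_const (𝕜 := ℝ) (x := y) v
  have hz := differentiableAt_const (𝕜 := ℝ) (x := y) z
  have hderiv := DFunLike.congr_fun
    (fderiv_eq_of_eqOn h.isOpen (fun x hx => h.inner_ricciOp hx v z) hy) w
  rw [h.fderiv_inner hy (hOp.clm_apply hv) hz, covDeriv_clm_apply hOp hv,
    fderiv_bilin_apply (G := G) hRic hv hz, map_add, add_apply, h.inner_ricciOp hy,
    h.inner_ricciOp hy] at hderiv
  linarith

end IsMetricOn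

end Ricci

section PointwiseStructure

variable {E : Type*} [NormedAddCommGroup E] [NormedSpace ℝ E] {ι : Type*} [Fintype ι]
  [DecidableEq ι]

/-- A weak metric `f`-structure on a single vector space: the pointwise axioms of
`WeakMetricFStructure`, where `η i` is a linear form for each index `i`. -/
structure IsWeakMetricF (f Q : E →L[ℝ] E) (ξ : ι → E) (η : ι → E →L[ℝ] ℝ)
    (g : E →L[ℝ] E →L[ℝ] ℝ) : Prop where
  nonsingular : Function.Bijective Q
  f_cubed : ∀ x, f (f (f x)) + f (Q x) = 0
  f_squared : ∀ x, f (f x) = -(Q x) + ∑ i, η i x • ξ i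
  eta_xi : ∀ i j, η i (ξ j) = if i = j then 1 else 0
  Q_xi : ∀ i, Q (ξ i) = ξ i
  f_invariant : ∀ x, (∀ i, η i x = 0) → ∀ i, η i (f x) = 0
  compatible : ∀ x y, g (f x) (f y) = g x (Q y) - ∑ i, η i x * η i y
  symm : ∀ x y, g x y = g y x

namespace IsWeakMetricF

variable {f Q : E →L[ℝ] E} {ξ : ι → E} {η : ι → E →L[ℝ] ℝ} {g : E →L[ℝ] E →L[ℝ] ℝ}
  (h : IsWeakMetricF f Q ξ η g)
include h

theorem f_xi (i : ι) : f (ξ i) = 0 := by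
  have hff : f (f (ξ i)) = 0 := by simp [h.f_squared, h.Q_xi, h.eta_xi]
  simpa [hff, h.Q_xi] using h.f_cubed (ξ i)

theorem eta_f (i : ι) (x : E) : η i (f x) = 0 := by
  simpa [h.f_xi] using h.f_invariant (x - ∑ j, η j x • ξ j) (fun i => by simp [h.eta_xi]) i

theorem eta_eq (i : ι) (x : E) : η i x = g (ξ i) x := by
  have hcompat := h.compatible x (ξ i)
  simp only [h.f_xi, map_zero, h.Q_xi, h.eta_xi, mul_ite, mul_one, mul_zero,
    Finset.sum_ite_eq', Finset.mem_univ, if_true] at hcompat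
  rw [h.symm]
  linarith

theorem orthonormal (i j : ι) : g (ξ i) (ξ j) = if i = j then 1 else 0 := by
  rw [← h.eta_eq, h.eta_xi]

theorem eq_sum_of_f_eq_zero {x : E} (hx : f x = 0) : x = ∑ i, η i x • ξ i := by
  have hQ := h.f_squared x
  rw [hx, map_zero, eq_comm, neg_add_eq_zero] at hQ
  apply h.nonsingular.1
  simp only [hQ, map_sum, map_smul, h.Q_xi]

theorem f_Q (x : E) : f (Q x) = Q (f x) := by
  have hcubed := h.f_cubed x
  rw [h.f_squared (f x)] at hcubed
  simp only [h.eta_f, zero_smul, Finset.sum_const_zero, add_zero] at hcubed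
  exact (neg_add_eq_zero.1 hcubed).symm

theorem f_skew (x y : E) : g (f x) y = - g x (f y) := by
  obtain ⟨z, rfl⟩ := h.nonsingular.2 y
  have hξ (i : ι) : g (f x) (ξ i) = 0 := by rw [h.symm, ← h.eta_eq, h.eta_f]
  have hff : g (f x) (f (f z)) = - g (f x) (Q z) := by simp [h.f_squared, hξ]
  have hcompat := h.compatible x (f z)
  simp only [h.eta_f, mul_zero, Finset.sum_const_zero, sub_zero] at hcompat
  rw [h.f_Q]
  linarith

theorem f_squared_symm (x y : E) : g (f (f x)) y = g (f (f y)) x := by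
  rw [h.f_skew, h.f_skew, neg_neg, h.symm]

end IsWeakMetricF

end PointwiseStructure

section Normality

variable {E : Type*} [NormedAddCommGroup E] [NormedSpace ℝ E]
  {G : E → E →L[ℝ] E →L[ℝ] ℝ} {U : Set E} {y : E}

theorem nijenhuis_const {f : E → E →L[ℝ] E} (hf : DifferentiableAt ℝ f y) (u v : E) :
    nijenhuis f (fun _ => u) (fun _ => v) y = fderiv ℝ f y (f y u) v - fderiv ℝ f y (f y v) u
      + f y (fderiv ℝ f y v u) - f y (fderiv ℝ f y u v) := by
  simp only [nijenhuis, VectorField.lieBracket, fderiv_clm_apply_const hf, fderiv_fun_const,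
    Pi.zero_apply, zero_apply, sub_zero, zero_sub, map_zero, map_neg, zero_add, sub_neg_eq_add]

theorem IsMetricOn.nijenhuis_const_eq_covDerivEndo [FiniteDimensional ℝ E] (h : IsMetricOn G U)
    (hy : y ∈ U) {f : E → E →L[ℝ] E} (hf : DifferentiableAt ℝ f y) (u v : E) :
    nijenhuis f (fun _ => u) (fun _ => v) y =
      covDerivEndo G f y (f y u) v - covDerivEndo G f y (f y v) u
      + f y (covDerivEndo G f y v u) - f y (covDerivEndo G f y u v) := by
  simp only [nijenhuis_const hf, covDerivEndo_apply, map_add, map_sub]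
  rw [h.christoffel_symm hy (f y v) (f y u), h.christoffel_symm hy v u,
    h.christoffel_symm hy (f y u) v, h.christoffel_symm hy (f y v) u]
  abel

theorem IsMetricOn.two_mul_extDerivOneForm_const [FiniteDimensional ℝ E] (h : IsMetricOn G U)
    (hy : y ∈ U) {α : E → E →L[ℝ] ℝ} {X : E → E} (hX : DifferentiableAt ℝ X y)
    (hα : ∀ z ∈ U, ∀ w, α z w = G z (X z) w) (u v : E) :
    2 * extDerivOneForm α (fun _ => u) (fun _ => v) y =
      G y (covDeriv G u X y) v - G y (covDeriv G v X y) u := by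
  have hderiv (a b : E) : fderiv ℝ (fun z => α z a) y b =
      G y (covDeriv G b X y) a + G y (X y) (christoffel G y b a) := by
    rw [fderiv_eq_of_eqOn h.isOpen (fun z hz => hα z hz a) hy,
      h.fderiv_inner hy hX (differentiableAt_const a), covDeriv_const]
  simp only [extDerivOneForm, hderiv, VectorField.lieBracket, fderiv_fun_const, Pi.zero_apply,
    zero_apply, sub_zero, map_zero]
  rw [h.christoffel_symm hy v u]
  ring

/-- The braid argument of the fundamental lemma of Riemannian geometry. -/
theorem eq_zero_of_symm_of_skew {ι : Type*} {T : ι → ι → ι → ℝ}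
    (symm : ∀ i j k, T i j k = T k j i) (skew : ∀ i j k, T i j k = -T i k j) (i j k : ι) :
    T i j k = 0 := by
  linarith [symm i j k, skew k j i, symm k i j, skew j i k, symm j k i, skew i k j]

variable {ι : Type*} [Fintype ι]

/-- The field of projections along the span of the fields `ξ_k` onto its orthogonal complement,
for orthonormal fields `ξ_k`. -/
noncomputable def horizontalProj (G : E → E →L[ℝ] E →L[ℝ] ℝ) (ξ : ι → E → E) (y : E) : E →L[ℝ] E :=
  ContinuousLinearMap.id ℝ E - ∑ k, (G y (ξ k y)).smulRight (ξ k y)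

theorem horizontalProj_apply (G : E → E →L[ℝ] E →L[ℝ] ℝ) (ξ : ι → E → E) (y v : E) :
    horizontalProj G ξ y v = v - ∑ k, G y (ξ k y) v • ξ k y := by
  simp [horizontalProj]

variable [DecidableEq ι]

/-- An orthonormal family of fields `ξ_k` on `U` whose covariant derivatives are `β` times the
projection onto the orthogonal complement of their span. -/
structure IsKenmotsuFrame (G : E → E →L[ℝ] E →L[ℝ] ℝ) (U : Set E) (ξ : ι → E → E) (β : ℝ) :
    Prop extends IsMetricOn G U where
  smooth_xi : ∀ k, ContDiffOn ℝ ∞ (ξ k) U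
  orthonormal : ∀ y ∈ U, ∀ j k, G y (ξ j y) (ξ k y) = if j = k then 1 else 0
  covDeriv_xi : ∀ y ∈ U, ∀ j u, covDeriv G u (ξ j) y = β • horizontalProj G ξ y u

/-- A weak `β`-Kenmotsu `f`-structure on the open set `U` of the coordinate space. Normality is
required for constant fields only, since its left-hand side is tensorial. -/
structure IsWeakKenmotsuOn (f Q : E → E →L[ℝ] E) (ξ : ι → E → E) (η : ι → E → E →L[ℝ] ℝ)
    (G : E → E →L[ℝ] E →L[ℝ] ℝ) (U : Set E) (β : ℝ) : Prop extends IsMetricOn G U where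
  smooth_f : ContDiffOn ℝ ∞ f U
  smooth_xi : ∀ k, ContDiffOn ℝ ∞ (ξ k) U
  weakMetricF : ∀ y ∈ U, IsWeakMetricF (f y) (Q y) (fun k => ξ k y) (fun k => η k y) (G y)
  normal : ∀ y ∈ U, ∀ u v, nijenhuis f (fun _ => u) (fun _ => v) y
    + ∑ k, (2 * extDerivOneForm (η k) (fun _ => u) (fun _ => v) y) • ξ k y = 0
  nabla_f : ∀ y ∈ U, ∀ u v, covDerivEndo G f y u v =
    β • (G y (f y u) v • ∑ k, ξ k y - (∑ k, η k y v) • f y u)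

namespace IsWeakKenmotsuOn

variable {f Q : E → E →L[ℝ] E} {ξ : ι → E → E} {η : ι → E → E →L[ℝ] ℝ} {β : ℝ}
  (h : IsWeakKenmotsuOn f Q ξ η G U β) (hy : y ∈ U)
include h hy

theorem differentiableAt_f : DifferentiableAt ℝ f y :=
  differentiableAt_of_contDiffOn h.isOpen h.smooth_f hy

theorem differentiableAt_xi (k : ι) : DifferentiableAt ℝ (ξ k) y :=
  differentiableAt_of_contDiffOn h.isOpen (h.smooth_xi k) hy

theorem f_covDeriv_xi (j : ι) (u : E) : f y (covDeriv G u (ξ j) y) = β • f y u := by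
  have S := h.weakMetricF y hy
  have hfξ : covDeriv G u (fun z => f z (ξ j z)) y = 0 := by
    rw [covDeriv_congr h.isOpen (fun z hz => (h.weakMetricF z hz).f_xi j) hy, covDeriv_const,
      map_zero]
  have horth : G y (f y u) (ξ j y) = 0 := by rw [S.symm, ← S.eta_eq, S.eta_f]
  rw [covDeriv_clm_apply (h.differentiableAt_f hy) (h.differentiableAt_xi hy j),
    h.nabla_f y hy, horth] at hfξ
  simp only [S.eta_xi, Finset.sum_ite_eq', Finset.mem_univ, if_true, zero_smul, one_smul,
    zero_sub, smul_neg] at hfξ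
  exact (neg_add_eq_zero.1 hfξ).symm

theorem covDeriv_xi_eq_add_sum (j : ι) (u : E) : covDeriv G u (ξ j) y =
    β • horizontalProj G ξ y u + ∑ k, G y (covDeriv G u (ξ j) y) (ξ k y) • ξ k y := by
  have S := h.weakMetricF y hy
  have hker : f y (covDeriv G u (ξ j) y - β • u) = 0 := by
    rw [map_sub, map_smul, h.f_covDeriv_xi hy, sub_self]
  refine (sub_eq_iff_eq_add.1 (S.eq_sum_of_f_eq_zero hker)).trans ?_
  simp only [horizontalProj_apply, S.eta_eq, S.symm _ (ξ _ y), map_sub, map_smul, sub_smul,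
    Finset.sum_sub_distrib, smul_sub, Finset.smul_sum, smul_assoc]
  abel

variable [FiniteDimensional ℝ E]

theorem inner_covDeriv_xi_skew (u : E) (j k : ι) :
    G y (covDeriv G u (ξ j) y) (ξ k y) = - G y (covDeriv G u (ξ k) y) (ξ j y) := by
  have hconst : fderiv ℝ (fun z => G z (ξ j z) (ξ k z)) y u = 0 := by
    rw [fderiv_eq_of_eqOn h.isOpen (fun z hz => (h.weakMetricF z hz).orthonormal j k) hy]
    simp
  rw [h.fderiv_inner hy (h.differentiableAt_xi hy j) (h.differentiableAt_xi hy k),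
    h.symm y hy (ξ j y)] at hconst
  linarith

theorem nijenhuis_eq_zero (u v : E) : nijenhuis f (fun _ => u) (fun _ => v) y = 0 := by
  have S := h.weakMetricF y hy
  rw [h.nijenhuis_const_eq_covDerivEndo hy (h.differentiableAt_f hy)]
  simp only [h.nabla_f y hy, map_smul, map_sub, map_sum, S.f_xi, Finset.sum_const_zero, smul_zero,
    S.f_squared_symm u v]
  module

theorem extDerivOneForm_eta_eq_zero (k : ι) (u v : E) :
    extDerivOneForm (η k) (fun _ => u) (fun _ => v) y = 0 := by
  have hsum := congrArg (η k y) (h.normal y hy u v)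
  simpa [h.nijenhuis_eq_zero hy, (h.weakMetricF y hy).eta_xi] using hsum

theorem inner_covDeriv_xi_symm (k : ι) (u v : E) :
    G y (covDeriv G u (ξ k) y) v = G y (covDeriv G v (ξ k) y) u := by
  rw [← sub_eq_zero, ← h.two_mul_extDerivOneForm_const hy (h.differentiableAt_xi hy k)
    (fun z hz => (h.weakMetricF z hz).eta_eq k), h.extDerivOneForm_eta_eq_zero hy, mul_zero]

theorem covDeriv_xi_xi (l j : ι) : covDeriv G (ξ l y) (ξ j) y = 0 := by
  have S := h.weakMetricF y hy
  have hvert := eq_zero_of_symm_of_skew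
    (T := fun l j k => G y (covDeriv G (ξ l y) (ξ j) y) (ξ k y))
    (fun l j k => h.inner_covDeriv_xi_symm hy j _ _)
    (fun l j k => h.inner_covDeriv_xi_skew hy _ j k)
  rw [h.covDeriv_xi_eq_add_sum hy, horizontalProj_apply]
  simp [hvert, S.orthonormal]

theorem inner_covDeriv_xi_xi (j k : ι) (u : E) : G y (covDeriv G u (ξ j) y) (ξ k y) = 0 := by
  rw [h.inner_covDeriv_xi_symm hy, h.covDeriv_xi_xi hy, map_zero, zero_apply]

omit hy in
theorem isKenmotsuFrame : IsKenmotsuFrame G U ξ β where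
  toIsMetricOn := h.toIsMetricOn
  smooth_xi := h.smooth_xi
  orthonormal y hy := (h.weakMetricF y hy).orthonormal
  covDeriv_xi y hy j u := by
    rw [h.covDeriv_xi_eq_add_sum hy]
    simp [h.inner_covDeriv_xi_xi hy]

end IsWeakKenmotsuOn

end Normality

section FrameAlgebra

variable {E : Type*} [NormedAddCommGroup E] [NormedSpace ℝ E] {ι : Type*} [Fintype ι]

/-- The field `ξ̄ = ∑ ξ_k`; its metric dual is `η̄`. -/
noncomputable def frameSum (ξ : ι → E → E) (y : E) : E := ∑ k, ξ k y

theorem inner_frameSum (G : E → E →L[ℝ] E →L[ℝ] ℝ) (ξ : ι → E → E) (y v : E) :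
    G y (frameSum ξ y) v = ∑ k, G y (ξ k y) v := by
  simp [frameSum]

theorem inner_horizontalProj_left (G : E → E →L[ℝ] E →L[ℝ] ℝ) (ξ : ι → E → E) (y u v : E) :
    G y (horizontalProj G ξ y u) v = G y u v - ∑ k, G y (ξ k y) u * G y (ξ k y) v := by
  simp [horizontalProj_apply]

theorem traceCLM_comp_horizontalProj [FiniteDimensional ℝ E] (G : E → E →L[ℝ] E →L[ℝ] ℝ)
    (ξ : ι → E → E) (y : E) (A : E →L[ℝ] E) : traceCLM E (A ∘L horizontalProj G ξ y) =
      traceCLM E A - ∑ k, G y (ξ k y) (A (ξ k y)) := by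
  have hA : A ∘L horizontalProj G ξ y = A - ∑ k, (G y (ξ k y)).smulRight (A (ξ k y)) := by
    ext u
    simp [horizontalProj_apply]
  simp only [hA, map_sub, map_sum, traceCLM_smulRight]

end FrameAlgebra

namespace IsKenmotsuFrame

variable {E : Type*} [NormedAddCommGroup E] [NormedSpace ℝ E] {ι : Type*} [Fintype ι]
  [DecidableEq ι] {G : E → E →L[ℝ] E →L[ℝ] ℝ} {U : Set E} {ξ : ι → E → E} {β : ℝ}
  (h : IsKenmotsuFrame G U ξ β) {y : E} (hy : y ∈ U)
include h hy

local notation "P" => horizontalProj G ξ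
local notation "ξ̄" => frameSum ξ
local notation "s" => (Fintype.card ι : ℝ)
local notation "m" => (Module.finrank ℝ E - Fintype.card ι : ℝ)

section Projection

theorem inner_xi_proj (k : ι) (v : E) : G y (ξ k y) (P y v) = 0 := by
  simp [horizontalProj_apply, h.orthonormal y hy]

theorem inner_frameSum_proj (v : E) : G y (ξ̄ y) (P y v) = 0 := by
  simp [inner_frameSum, h.inner_xi_proj hy]

theorem inner_frameSum_xi (j : ι) : G y (ξ̄ y) (ξ j y) = 1 := by
  simp [inner_frameSum, h.orthonormal y hy]

theorem inner_frameSum_frameSum : G y (ξ̄ y) (ξ̄ y) = s := by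
  rw [inner_frameSum]
  simp [h.symm y hy _ (ξ̄ y), h.inner_frameSum_xi hy]

theorem proj_proj (v : E) : P y (P y v) = P y v := by
  rw [horizontalProj_apply G ξ y (P y v)]
  simp [h.inner_xi_proj hy]

theorem inner_proj_comm (u v : E) : G y (P y u) v = G y (P y v) u := by
  simp only [inner_horizontalProj_left, h.symm y hy u v, mul_comm]

theorem differentiableAt_xi (k : ι) : DifferentiableAt ℝ (ξ k) y :=
  differentiableAt_of_contDiffOn h.isOpen (h.smooth_xi k) hy

theorem differentiableAt_frameSum : DifferentiableAt ℝ ξ̄ y :=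
  DifferentiableAt.fun_sum fun k _ => h.differentiableAt_xi hy k

theorem differentiableAt_proj : DifferentiableAt ℝ P y := by
  have hG := h.differentiableAt hy
  have hξ := h.differentiableAt_xi hy
  unfold horizontalProj
  fun_prop

theorem covDeriv_frameSum (u : E) : covDeriv G u ξ̄ y = (s * β) • P y u := by
  unfold frameSum
  rw [covDeriv_fun_sum (h.differentiableAt_xi hy)]
  simp [h.covDeriv_xi y hy, mul_smul, Nat.cast_smul_eq_nsmul]

theorem covDeriv_covDeriv_xi (u v : E) (j : ι) : covDeriv G u (covDeriv G v (ξ j)) y =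
    β • (covDerivEndo G P y u v + P y (christoffel G y u v)) := by
  have hP := h.differentiableAt_proj hy
  rw [covDeriv_congr h.isOpen (fun z hz => h.covDeriv_xi z hz j v) hy,
    covDeriv_fun_const_smul β (by fun_prop),
    covDeriv_clm_apply hP (differentiableAt_const v), covDeriv_const]

end Projection

variable [FiniteDimensional ℝ E]

theorem traceCLM_proj : traceCLM E (P y) = m := by
  have htrace := traceCLM_comp_horizontalProj G ξ y (ContinuousLinearMap.id ℝ E)
  simpa [traceCLM_id, h.orthonormal y hy] using htrace

section Curvature

theorem covDerivEndo_proj (u v : E) : covDerivEndo G P y u v =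
    -β • (G y (P y u) v • ξ̄ y + G y (ξ̄ y) v • P y u) := by
  have hG := h.differentiableAt hy
  have hξ := h.differentiableAt_xi hy
  have hv := differentiableAt_const (𝕜 := ℝ) (x := y) v
  have hleibniz := covDeriv_clm_apply (G := G) (h.differentiableAt_proj hy) hv u
  simp only [horizontalProj_apply G ξ _ v] at hleibniz
  rw [covDeriv_fun_sub hv (by fun_prop), covDeriv_fun_sum (fun k => by fun_prop), covDeriv_const,
    horizontalProj_apply] at hleibniz
  have hsummand (k : ι) : covDeriv G u (fun z => G z (ξ k z) v • ξ k z) y =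
      (β * G y (P y u) v) • ξ k y + G y (ξ k y) (christoffel G y u v) • ξ k y
        + (β * G y (ξ k y) v) • P y u := by
    rw [covDeriv_fun_smul (by fun_prop) (hξ k), h.fderiv_inner hy (hξ k) hv, covDeriv_const,
      h.covDeriv_xi y hy, map_smul, smul_apply, smul_eq_mul]
    module
  simp only [hsummand, Finset.sum_add_distrib, ← Finset.smul_sum, ← Finset.sum_smul,
    ← Finset.mul_sum] at hleibniz
  rw [eq_sub_of_add_eq hleibniz.symm, inner_frameSum, frameSum]
  module

theorem curvature_xi (u v : E) (j : ι) : curvature G y u v (ξ j y) =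
    β ^ 2 • (G y (ξ̄ y) u • P y v - G y (ξ̄ y) v • P y u) := by
  rw [← covDeriv_commutator h.isOpen h.contDiffOn_christoffel (h.smooth_xi j) hy,
    h.covDeriv_covDeriv_xi hy, h.covDeriv_covDeriv_xi hy, h.covDerivEndo_proj hy,
    h.covDerivEndo_proj hy, h.christoffel_symm hy v u, h.inner_proj_comm hy v u]
  module

theorem curvature_xi_right (v z : E) (j : ι) : curvature G y v (ξ j y) z =
    β ^ 2 • (G y (P y z) v • ξ̄ y - G y (ξ̄ y) z • P y v) := by
  refine h.eq_of_inner_eq hy fun w => ?_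
  rw [h.inner_curvature_pair hy, h.inner_curvature_skew hy, h.curvature_xi hy]
  simp only [map_smul, map_sub, smul_apply, sub_apply, smul_eq_mul]
  rw [h.inner_proj_comm hy w v]
  ring

theorem covDerivCurvature_xi_right (u v z : E) (j : ι) : covDerivCurvature G y u v (ξ j y) z =
    β ^ 3 • (-(G y (ξ̄ y) v * G y (P y u) z) • ξ̄ y + (s * G y (P y z) v) • P y u
      - (s * G y (P y u) z) • P y v + (G y (ξ̄ y) z * G y (ξ̄ y) v) • P y u)
    - β • curvature G y v (P y u) z := by
  have hG := h.differentiableAt hy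
  have hP := h.differentiableAt_proj hy
  have hξ := h.differentiableAt_frameSum hy
  have hconst (x : E) := differentiableAt_const (𝕜 := ℝ) (x := y) x
  have covDeriv_proj_apply (x : E) : covDeriv G u (fun z => P z x) y =
      covDerivEndo G P y u x + P y (christoffel G y u x) := by
    rw [covDeriv_clm_apply hP (hconst x), covDeriv_const]
  have hleibniz := covDeriv_curvature_apply (h.differentiableAt_curvature hy) (hconst v)
    (h.differentiableAt_xi hy j) (hconst z) u
  rw [covDeriv_congr h.isOpen (fun x hx => h.curvature_xi_right hx v z j) hy,
    covDeriv_fun_const_smul _ (by fun_prop), covDeriv_fun_sub (by fun_prop) (by fun_prop),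
    covDeriv_fun_smul (by fun_prop) hξ, covDeriv_fun_smul (by fun_prop) (by fun_prop),
    h.fderiv_inner hy (by fun_prop) (hconst v), h.fderiv_inner hy hξ (hconst z),
    covDeriv_proj_apply, covDeriv_proj_apply, covDeriv_const, covDeriv_const,
    h.covDeriv_frameSum hy, h.covDeriv_xi y hy, h.covDerivEndo_proj hy, h.covDerivEndo_proj hy,
    h.curvature_xi_right hy, h.curvature_xi_right hy, map_smul, smul_apply] at hleibniz
  rw [← sub_eq_iff_eq_add, ← sub_eq_iff_eq_add, ← sub_eq_iff_eq_add] at hleibniz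
  rw [← hleibniz]
  simp only [map_smul, map_add, smul_apply, add_apply, smul_eq_mul]
  rw [h.inner_proj_comm hy z (christoffel G y u v)]
  module

theorem covDerivCurvature_xi_left_of_horizontal {v z : E} (hv : P y v = v) (hz : P y z = z)
    (u : E) (j : ι) : covDerivCurvature G y (ξ j y) u v z =
      β ^ 3 • (-(2 * s * G y v z) • P y u + (2 * s * G y z u) • v
        - (G y (ξ̄ y) u * G y v z) • ξ̄ y)
      + β • curvature G y v (P y u) z - β • curvature G y u v z := by
  have hηv : G y (ξ̄ y) v = 0 := by rw [← hv, h.inner_frameSum_proj hy]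
  have hηz : G y (ξ̄ y) z = 0 := by rw [← hz, h.inner_frameSum_proj hy]
  have hbianchi := h.bianchi_second hy u v (ξ j y) z
  rw [covDerivCurvature_antisymm (h.differentiableAt_curvature hy) v,
    h.covDerivCurvature_xi_right hy, h.covDerivCurvature_xi_right hy,
    h.inner_proj_comm hy u z, hv, hz, hηv, hηz, h.symm y hy z v] at hbianchi
  rw [← sub_eq_zero, ← hbianchi]
  module

end Curvature

section Ricci

theorem traceCLM_curvature_comp_proj (v z : E) :
    traceCLM E (((curvature G y).flip v).flip z ∘L P y) =
      ricci G y v z + s * β ^ 2 * G y (P y z) v := by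
  have hsummand (k : ι) : G y (ξ k y) (curvature G y (ξ k y) v z) = -(β ^ 2 * G y (P y z) v) := by
    rw [curvature_antisymm, h.curvature_xi_right hy, h.symm y hy (ξ k y)]
    simp [h.inner_frameSum_xi hy, h.symm y hy _ (ξ k y), h.inner_xi_proj hy]
  rw [traceCLM_comp_horizontalProj, ← ricci_eq_traceCLM]
  simp only [ContinuousLinearMap.flip_apply, hsummand, Finset.sum_const, Finset.card_univ,
    nsmul_eq_mul]
  ring

theorem covDerivBilin_ricci_xi_of_horizontal {v z : E} (hv : P y v = v) (hz : P y z = z)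
    (j : ι) : covDerivBilin G (ricci G) y (ξ j y) v z =
      -(2 * β) * (ricci G y v z + s * m * β ^ 2 * G y v z) := by
  have hR : ((covDerivCurvature G y (ξ j y)).flip v).flip z =
      β ^ 3 • (-(2 * s * G y v z) • P y + (2 * s) • (G y z).smulRight v
        - G y v z • (G y (ξ̄ y)).smulRight (ξ̄ y))
      - β • ((curvature G y).flip v).flip z ∘L P y - β • ((curvature G y).flip v).flip z := by
    ext u
    simp only [ContinuousLinearMap.flip_apply, add_apply, sub_apply, smul_apply,
      ContinuousLinearMap.comp_apply, ContinuousLinearMap.smulRight_apply,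
      h.covDerivCurvature_xi_left_of_horizontal hy hv hz, curvature_antisymm G y v]
    module
  rw [covDerivBilin_ricci (h.differentiableAt_curvature hy), hR]
  simp only [map_add, map_sub, map_smul, traceCLM_smulRight, h.traceCLM_proj hy,
    h.inner_frameSum_frameSum hy, h.symm y hy z v, ← ricci_eq_traceCLM, smul_eq_mul,
    h.traceCLM_curvature_comp_proj hy, hz]
  ring

theorem ricci_xi_left (v : E) (j : ι) : ricci G y (ξ j y) v = -(m * β ^ 2) * G y (ξ̄ y) v := by
  have hR : ((curvature G y).flip (ξ j y)).flip v =
      β ^ 2 • ((G y (P y v)).smulRight (ξ̄ y) - G y (ξ̄ y) v • P y) := by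
    ext u
    simp [h.curvature_xi_right hy]
  rw [ricci_eq_traceCLM, hR, map_smul, map_sub, map_smul, traceCLM_smulRight, h.traceCLM_proj hy,
    h.symm y hy, h.inner_frameSum_proj hy]
  simp only [smul_eq_mul]
  ring

theorem ricci_sub_proj_left (u v : E) :
    ricci G y (u - P y u) v = -(m * β ^ 2) * (G y (ξ̄ y) u * G y (ξ̄ y) v) := by
  rw [horizontalProj_apply, sub_sub_cancel, inner_frameSum G ξ y u, Finset.sum_mul,
    Finset.mul_sum]
  simp only [map_sum, map_smul, sum_apply, smul_apply, h.ricci_xi_left hy, smul_eq_mul]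
  exact Finset.sum_congr rfl fun k _ => by ring

variable (hβ : β ≠ 0) {j : ι} (hj : covDerivEndo G (ricciOp G) y (ξ j y) = 0)
include hβ hj

theorem ricci_of_horizontal {v z : E} (hv : P y v = v) (hz : P y z = z) :
    ricci G y v z = -(s * m * β ^ 2) * G y v z := by
  have hderiv := h.covDerivBilin_ricci_xi_of_horizontal hy hv hz j
  rw [h.covDerivBilin_ricci_eq_inner hy, hj, zero_apply, map_zero, zero_apply] at hderiv
  have hsum := (mul_eq_zero.1 hderiv.symm).resolve_left (by simpa using hβ)
  linarith

theorem ricci_eq (u v : E) : ricci G y u v =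
    -(m * β ^ 2) * (s * G y (P y u) v + G y (ξ̄ y) u * G y (ξ̄ y) v) := by
  have hsplit : ricci G y u v = ricci G y (P y u) (P y v) + ricci G y (v - P y v) (P y u)
      + ricci G y (u - P y u) v := by
    rw [h.ricci_symm hy (v - P y v)]
    simp only [map_sub, sub_apply]
    ring
  rw [hsplit, h.ricci_sub_proj_left hy, h.ricci_sub_proj_left hy, h.inner_frameSum_proj hy,
    h.ricci_of_horizontal hy hβ hj (h.proj_proj hy u) (h.proj_proj hy v),
    h.symm y hy (P y u), h.inner_proj_comm hy v, h.proj_proj hy]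
  ring

theorem scalarCurvature_eq : scalarCurvature G y = -(m * β ^ 2) * (s * (m + 1)) := by
  have hOp : ricciOp G y = -(m * β ^ 2) • (s • P y + (G y (ξ̄ y)).smulRight (ξ̄ y)) := by
    ext u
    refine h.eq_of_inner_eq hy fun v => ?_
    rw [h.inner_ricciOp hy, h.ricci_eq hy hβ hj]
    simp [mul_add]
  change traceCLM E (ricciOp G y) = _
  rw [hOp, map_smul, map_add, map_smul, traceCLM_smulRight, h.traceCLM_proj hy,
    h.inner_frameSum_frameSum hy]
  simp only [smul_eq_mul]
  ring

end Ricci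

end IsKenmotsuFrame

end LocalRiem

namespace ChartRep

variable {E : Type*} [NormedAddCommGroup E] [NormedSpace ℝ E]
  {M : Type*} [TopologicalSpace M] [ChartedSpace E M]

section Inverse

variable [IsManifold 𝓘(ℝ, E) ∞ M] {c : M} {y : E} (hy : y ∈ (extChartAt 𝓘(ℝ, E) c).target)
include hy

theorem ofTangent_toTangent (u : E) : ofTangent c y (toTangent c y u) = u := by
  have hcomp := mfderiv_extChartAt_comp_mfderivWithin_extChartAt_symm (I := 𝓘(ℝ, E)) hy
  rw [ModelWithCorners.range_eq_univ, mfderivWithin_univ] at hcomp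
  exact DFunLike.congr_fun hcomp u

theorem toTangent_ofTangent (X : TangentSpace 𝓘(ℝ, E) (pt c y)) :
    toTangent c y (ofTangent c y X) = X := by
  have hcomp := mfderivWithin_extChartAt_symm_comp_mfderiv_extChartAt (I := 𝓘(ℝ, E)) hy
  rw [ModelWithCorners.range_eq_univ, mfderivWithin_univ] at hcomp
  exact DFunLike.congr_fun hcomp X

theorem bijective_ofTangent : Function.Bijective (ofTangent c y) :=
  Function.bijective_iff_has_inverse.2
    ⟨toTangent c y, toTangent_ofTangent hy, ofTangent_toTangent hy⟩

theorem bijective_toTangent : Function.Bijective (toTangent c y) :=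
  Function.bijective_iff_has_inverse.2
    ⟨ofTangent c y, ofTangent_toTangent hy, toTangent_ofTangent hy⟩

theorem trivializationAt_snd (X : TangentSpace 𝓘(ℝ, E) (pt c y)) :
    (trivializationAt E (TangentSpace 𝓘(ℝ, E)) c ⟨pt c y, X⟩).2 = ofTangent c y X := by
  have hpt : pt c y ∈ (chartAt E c).source := by
    simpa [pt] using (extChartAt 𝓘(ℝ, E) c).map_target hy
  rw [ofTangent, ← TangentBundle.continuousLinearMapAt_trivializationAt (I := 𝓘(ℝ, E)) hpt,
    Trivialization.continuousLinearMapAt_apply, Trivialization.linearMapAt_apply, if_pos]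
  simpa using hpt

theorem mk_mem_trivializationAt_source (X : TangentSpace 𝓘(ℝ, E) (pt c y)) :
    (⟨pt c y, X⟩ : TotalSpace E (TangentSpace 𝓘(ℝ, E) : M → Type _)) ∈
      (trivializationAt E (TangentSpace 𝓘(ℝ, E)) c).source := by
  rw [Trivialization.mem_source]
  simpa [pt] using (extChartAt 𝓘(ℝ, E) c).map_target hy

end Inverse

variable [IsManifold 𝓘(ℝ, E) ∞ M] (c : M)

theorem contMDiffOn_pt :
    ContMDiffOn 𝓘(ℝ, E) 𝓘(ℝ, E) ∞ (pt c : E → M) (extChartAt 𝓘(ℝ, E) c).target :=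
  contMDiffOn_extChartAt_symm c

theorem contDiffOn_ofTangent {V : Π y : E, TangentSpace 𝓘(ℝ, E) (pt c y)}
    (hV : ContMDiffOn 𝓘(ℝ, E) (𝓘(ℝ, E).prod 𝓘(ℝ, E)) ∞
      (fun y => TotalSpace.mk' E (E := (TangentSpace 𝓘(ℝ, E) : M → Type _)) (pt c y) (V y))
      (extChartAt 𝓘(ℝ, E) c).target) :
    ContDiffOn ℝ ∞ (fun y => ofTangent c y (V y)) (extChartAt 𝓘(ℝ, E) c).target := by
  rw [Trivialization.contMDiffOn_iff (fun y hy => mk_mem_trivializationAt_source hy (V y))] at hV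
  exact hV.2.contDiffOn.congr fun y hy => (trivializationAt_snd hy (V y)).symm

theorem contMDiffOn_toTangent (u : E) :
    ContMDiffOn 𝓘(ℝ, E) (𝓘(ℝ, E).prod 𝓘(ℝ, E)) ∞
      (fun y => TotalSpace.mk' E (E := (TangentSpace 𝓘(ℝ, E) : M → Type _)) (pt c y)
        (toTangent c y u))
      (extChartAt 𝓘(ℝ, E) c).target := by
  rw [Trivialization.contMDiffOn_iff (fun y hy => mk_mem_trivializationAt_source hy _)]
  refine ⟨contMDiffOn_pt c, (contMDiffOn_const (c := u)).congr fun y hy => ?_⟩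
  exact (trivializationAt_snd hy _).trans (ofTangent_toTangent hy u)

theorem contDiffOn_vec {X : Π p : M, TangentSpace 𝓘(ℝ, E) p}
    (hX : ContMDiff 𝓘(ℝ, E) (𝓘(ℝ, E).prod 𝓘(ℝ, E)) ∞
      (fun p => TotalSpace.mk' E (E := fun p : M => TangentSpace 𝓘(ℝ, E) p) p (X p))) :
    ContDiffOn ℝ ∞ (vec X c) (extChartAt 𝓘(ℝ, E) c).target :=
  contDiffOn_ofTangent c (hX.comp_contMDiffOn (contMDiffOn_pt c))

variable [FiniteDimensional ℝ E]

theorem contDiffOn_endo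
    {A : Π p : M, TangentSpace 𝓘(ℝ, E) p →L[ℝ] TangentSpace 𝓘(ℝ, E) p}
    (hA : ContMDiff 𝓘(ℝ, E) (𝓘(ℝ, E).prod 𝓘(ℝ, E →L[ℝ] E)) ∞
      (fun p => TotalSpace.mk' (E →L[ℝ] E)
        (E := fun p : M => TangentSpace 𝓘(ℝ, E) p →L[ℝ] TangentSpace 𝓘(ℝ, E) p) p (A p))) :
    ContDiffOn ℝ ∞ (endo A c) (extChartAt 𝓘(ℝ, E) c).target :=
  contDiffOn_clm_apply.2 fun u => contDiffOn_ofTangent c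
    (ContMDiffOn.clm_bundle_apply (F₁ := E) (F₂ := E)
      (hA.comp_contMDiffOn (contMDiffOn_pt c)) (contMDiffOn_toTangent c u))

theorem contDiffOn_bilin
    {B : Π p : M, TangentSpace 𝓘(ℝ, E) p →L[ℝ] TangentSpace 𝓘(ℝ, E) p →L[ℝ] ℝ}
    (hB : ContMDiff 𝓘(ℝ, E) (𝓘(ℝ, E).prod 𝓘(ℝ, E →L[ℝ] E →L[ℝ] ℝ)) ∞
      (fun p => TotalSpace.mk' (E →L[ℝ] E →L[ℝ] ℝ)
        (E := fun p : M => TangentSpace 𝓘(ℝ, E) p →L[ℝ] TangentSpace 𝓘(ℝ, E) p →L[ℝ] ℝ)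
          p (B p))) :
    ContDiffOn ℝ ∞ (bilin B c) (extChartAt 𝓘(ℝ, E) c).target := by
  refine contDiffOn_clm_apply.2 fun u => contDiffOn_clm_apply.2 fun v => ?_
  have hsection : ContMDiffOn 𝓘(ℝ, E) (𝓘(ℝ, E).prod 𝓘(ℝ)) ∞
      (fun y => TotalSpace.mk' ℝ (E := Bundle.Trivial M ℝ) (pt c y)
        (B (pt c y) (toTangent c y u) (toTangent c y v))) (extChartAt 𝓘(ℝ, E) c).target :=
    ContMDiffOn.clm_bundle_apply₂ (F₁ := E) (F₂ := E) (hB.comp_contMDiffOn (contMDiffOn_pt c))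
      (contMDiffOn_toTangent c u) (contMDiffOn_toTangent c v)
  intro y hy
  exact (contMDiffWithinAt_totalSpace.1 (hsection y hy)).2.contDiffWithinAt

end ChartRep

theorem sum_sum_filter_ne_mul {ι R : Type*} [Fintype ι] [DecidableEq ι] [CommRing R] (a b : ι → R) :
    ∑ k, ∑ l ∈ Finset.univ.filter (fun l => l ≠ k), a k * b l =
      (∑ k, a k) * (∑ k, b k) - ∑ k, a k * b k := by
  rw [Finset.sum_mul_sum, ← Finset.sum_sub_distrib]
  refine Finset.sum_congr rfl fun k _ => ?_
  rw [Finset.filter_ne', ← Finset.add_sum_erase Finset.univ _ (Finset.mem_univ k),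
    add_sub_cancel_left]

namespace WeakMetricFStructure

open ChartRep LocalRiem

variable {n s : ℕ} {M : Type*} [TopologicalSpace M] [ChartedSpace (CoordSpace n s) M]
  [IsManifold 𝓘(ℝ, CoordSpace n s) ∞ M]

section Charts

variable (S : WeakMetricFStructure n s M) (c : M)

theorem localMetric_apply (y u v : CoordSpace n s) : S.localMetric c y u v =
    S.g.inner (pt c y) (toTangent c y u) (toTangent c y v) := rfl

theorem isMetricOn_localMetric :
    IsMetricOn (S.localMetric c) (extChartAt 𝓘(ℝ, CoordSpace n s) c).target where
  isOpen := isOpen_extChartAt_target c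
  smooth := contDiffOn_bilin c S.g.contMDiff
  symm y _ u v := by rw [localMetric_apply, localMetric_apply, S.g.symm]
  pos y hy u hu := by
    rw [localMetric_apply]
    refine S.g.pos _ _ fun hzero => hu ?_
    rw [← ofTangent_toTangent hy u, hzero, map_zero]

theorem isWeakMetricF_chart {y : CoordSpace n s}
    (hy : y ∈ (extChartAt 𝓘(ℝ, CoordSpace n s) c).target) :
    IsWeakMetricF (endo S.f c y) (endo S.Q c y) (fun k => vec (S.ξ k) c y)
      (fun k => form (S.η k) c y) (S.localMetric c y) where
  nonsingular := (bijective_ofTangent hy).comp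
    ((S.nonsingular_Q (pt c y)).comp (bijective_toTangent hy))
  f_cubed X := by
    have hcubed := congrArg (ofTangent c y) (S.f_cubed (pt c y) (toTangent c y X))
    rw [map_add, map_zero] at hcubed
    simpa only [endo, ContinuousLinearMap.comp_apply, toTangent_ofTangent hy] using hcubed
  f_squared X := by
    have hsquared := congrArg (ofTangent c y) (S.f_squared (pt c y) (toTangent c y X))
    rw [map_add, map_neg, map_sum] at hsquared
    simp only [map_smul] at hsquared
    simpa only [endo, vec, form, ContinuousLinearMap.comp_apply, toTangent_ofTangent hy]
      using hsquared
  eta_xi i j := by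
    simp only [vec, form, ContinuousLinearMap.comp_apply, toTangent_ofTangent hy]
    exact S.η_ξ _ i j
  Q_xi i := by
    simp only [vec, endo, ContinuousLinearMap.comp_apply, toTangent_ofTangent hy, S.Q_ξ]
  f_invariant X hX i := by
    simp only [form, endo, ContinuousLinearMap.comp_apply, toTangent_ofTangent hy] at hX ⊢
    exact S.f_invariant _ _ hX i
  compatible X Y := by
    simpa only [localMetric_apply, form, endo, ContinuousLinearMap.comp_apply,
      toTangent_ofTangent hy] using S.compatible (pt c y) (toTangent c y X) (toTangent c y Y)
  symm := (S.isMetricOn_localMetric c).symm y hy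

theorem vec_xiBar (y : CoordSpace n s) : vec S.xiBar c y = ∑ k, vec (S.ξ k) c y := by
  simp only [vec, xiBar, map_sum]

theorem form_etaBar_apply (y v : CoordSpace n s) :
    form S.etaBar c y v = ∑ k, form (S.η k) c y v := by
  simp only [form, etaBar, ContinuousLinearMap.comp_apply, sum_apply]

end Charts

namespace IsWeakKenmotsu

variable {S : WeakMetricFStructure n s M} {β : ℝ} (hK : S.IsWeakKenmotsu fun _ => β) (c : M)
include hK

theorem isWeakKenmotsuOn :
    IsWeakKenmotsuOn (endo S.f c) (endo S.Q c) (fun k => vec (S.ξ k) c) (fun k => form (S.η k) c)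
      (S.localMetric c) (extChartAt 𝓘(ℝ, CoordSpace n s) c).target β where
  toIsMetricOn := S.isMetricOn_localMetric c
  smooth_f := contDiffOn_endo c S.smooth_f
  smooth_xi k := contDiffOn_vec c (S.smooth_ξ k)
  weakMetricF _ hy := S.isWeakMetricF_chart c hy
  normal y hy _ _ := hK.normal c y hy _ _ contDiff_const contDiff_const
  nabla_f y hy u v := by
    rw [← vec_xiBar, ← form_etaBar_apply]
    exact hK.nabla_f c y hy u v

variable {c} {y : CoordSpace n s} (hy : y ∈ (extChartAt 𝓘(ℝ, CoordSpace n s) c).target) {i : Fin s}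
  (hi : covDerivEndo (S.localMetric c) (ricciOp (S.localMetric c)) y (vec (S.ξ i) c y) = 0)
include hy hi

theorem ricci_eq (u v : CoordSpace n s) : ricci (S.localMetric c) y u v =
    -2 * s * n * β ^ 2 * S.localMetric c y u v
      + 2 * n * (s - 1) * β ^ 2 * ∑ k, form (S.η k) c y u * form (S.η k) c y v
      + (-2 * s * n * β ^ 2 + 2 * n * (s - 1) * β ^ 2) *
        ∑ k, ∑ l ∈ Finset.univ.filter (fun l => l ≠ k),
          form (S.η k) c y u * form (S.η l) c y v := by
  have hη (k : Fin s) (w : CoordSpace n s) :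
      form (S.η k) c y w = S.localMetric c y (vec (S.ξ k) c y) w :=
    (S.isWeakMetricF_chart c hy).eta_eq k w
  rw [(hK.isWeakKenmotsuOn c).isKenmotsuFrame.ricci_eq hy (hK.β_ne_zero c) hi,
    inner_horizontalProj_left, inner_frameSum, inner_frameSum, sum_sum_filter_ne_mul]
  simp only [hη, finrank_euclideanSpace, Fintype.card_fin, Nat.cast_add, Nat.cast_mul,
    Nat.cast_ofNat]
  ring

theorem scalarCurvature_eq :
    scalarCurvature (S.localMetric c) y = -2 * s * n * (2 * n + 1) * β ^ 2 := by
  rw [(hK.isWeakKenmotsuOn c).isKenmotsuFrame.scalarCurvature_eq hy (hK.β_ne_zero c) hi]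
  simp only [finrank_euclideanSpace, Fintype.card_fin, Nat.cast_add, Nat.cast_mul,
    Nat.cast_ofNat]
  ring

end IsWeakKenmotsu

end WeakMetricFStructure

theorem theorem2p3_general (n s : ℕ)
    (M : Type*) [TopologicalSpace M] [ChartedSpace (CoordSpace n s) M]
    [IsManifold 𝓘(ℝ, CoordSpace n s) ∞ M]
    (S : WeakMetricFStructure n s M) (β : ℝ) (hK : S.IsWeakKenmotsu (fun _ => β))
    (hRic : ∀ c : M, ∀ y ∈ (extChartAt 𝓘(ℝ, CoordSpace n s) c).target, ∃ i : Fin s,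
      LocalRiem.covDerivEndo (S.localMetric c) (LocalRiem.ricciOp (S.localMetric c)) y
        (ChartRep.vec (S.ξ i) c y) = 0) :
    S.IsEtaEinstein ∧
      S.HasScalarCurvature (-2 * (s : ℝ) * (n : ℝ) * (2 * (n : ℝ) + 1) * β ^ 2) := by
  refine ⟨⟨fun _ => -2 * s * n * β ^ 2, fun _ => 2 * n * (s - 1) * β ^ 2, contMDiff_const,
    contMDiff_const, fun c y hy => ?_⟩, fun c y hy => ?_⟩
  · obtain ⟨i, hi⟩ := hRic c y hy
    exact hK.ricci_eq hy hi
  · obtain ⟨i, hi⟩ := hRic c y hy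
    exact hK.scalarCurvature_eq hy hi

theorem theorem2p3 (n s : ℕ) (hn : 0 < n) (hs : 1 < s)
    (M : Type*) [TopologicalSpace M] [ChartedSpace (CoordSpace n s) M]
    [IsManifold 𝓘(ℝ, CoordSpace n s) ∞ M]
    (S : WeakMetricFStructure n s M) (β : ℝ)
    (hK : S.IsWeakKenmotsu (fun _ => β))
    (i : Fin s) (hRic : S.NablaXiRicciOpEqZero i) :
    S.IsEtaEinstein ∧
      S.HasScalarCurvature (-2 * (s : ℝ) * (n : ℝ) * (2 * (n : ℝ) + 1) * β ^ 2) :=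
  theorem2p3_general n s M S β hK fun c y hy => ⟨i, hRic c y hy⟩
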